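/- Consider propositional modal logic with countably many propositional variables $p_0,p_1,\dots$ and one modality $\Box$ (with $\Diamond=\neg\Box\neg$). A normal modal logic is a set of formulas that contains all classical propositional tautologies and $\Box(p_0\to p_1)\to(\Box p_0\to\Box p_1)$ and is closed under modus ponens, uniform substitution and necessitation; it is consistent if it does not contain $\bot$. The normal modal logics form a complete lattice under inclusion. A normal modal logic $\mathsf L_2$ is a splitting of this lattice if there is a normal modal logic $\mathsf L_1$ such that for every normal modal logic $\mathsf L$ either $\mathsf L\subseteq \mathsf L_1$ or $\mathsf L_2\subseteq \mathsf L$, but not both. A normal modal logic is a join-splitting if it is the join of a (possibly empty) family of splittings. A $\mathcal V$-BAO is a Boolean algebra with a unary operation $\Diamond$ that preserves finite joins (including $\bot$) and is completely additive: for every set $X$ of elements whose join $\bigvee X$ exists, $\bigvee\{\Diamond x\mid x\in X\}$ exists and $\Diamond\bigvee X=\bigvee\{\Diamond x\mid x\in X\}$. A logic is valid over such an algebra if each of its formulas takes the value $\top$ under every assignment of elements to the variables. The degree of $\mathcal V$-incompleteness of a normal modal logic $\mathsf L$ is the cardinality of the set of normal modal logics $\mathsf L'$ such that $\mathsf L$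 and $\mathsf L'$ are valid over exactly the same $\mathcal V$-BAOs. Theorem (Blok Dichotomy for $\mathcal V$-incompleteness). If a consistent normal modal logic $\mathsf L$ is not a join-splitting of the lattice of normal modal logics, then $\mathsf L$ has degree of $\mathcal V$-incompleteness $2^{\aleph_0}$. -/

import Mathlib

universe u

namespace ModalLogic

/-- Formulas of propositional unimodal logic over the variables `p₀, p₁, …`. The connectives
`⊥`, `→`, `□` are taken as primitive, the others are abbreviations. -/
inductive Formula : Type
  | var : ℕ → Formula
  | bot : Formula
  | imp : Formula → Formula → Formula
  | box : Formula → Formula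

namespace Formula

def neg (φ : Formula) : Formula := imp φ bot

def top : Formula := neg bot

def or (φ ψ : Formula) : Formula := imp (neg φ) ψ

def and (φ ψ : Formula) : Formula := neg (imp φ (neg ψ))

def dia (φ : Formula) : Formula := neg (box (neg φ))

/-- Uniform (simultaneous) substitution of formulas for variables. -/
def subst (s : ℕ → Formula) : Formula → Formula
  | var n => s n
  | bot => bot
  | imp φ ψ => imp (subst s φ) (subst s ψ)
  | box φ => box (subst s φ)

/-- Classical truth value of a formula, where variables and formulas `□φ` are treated as atoms
whose truth values are given by `v`. -/
def Truth (v : Formula → Prop) : Formula → Prop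
  | var n => v (var n)
  | bot => False
  | imp φ ψ => Truth v φ → Truth v ψ
  | box φ => v (box φ)

/-- Tautologies of classical propositional logic (in the modal language). -/
def IsTautology (φ : Formula) : Prop := ∀ v : Formula → Prop, Truth v φ

/-- The axiom `□(p₀ → p₁) → (□p₀ → □p₁)`. -/
def axiomK : Formula :=
  imp (box (imp (var 0) (var 1))) (imp (box (var 0)) (box (var 1)))

end Formula

/-- A set of formulas is a normal modal logic. -/
structure IsNormalLogic (L : Set Formula) : Prop where
  tautology : ∀ φ, φ.IsTautology → φ ∈ L
  modusPonens : ∀ φ ψ, φ ∈ L → Formula.imp φ ψ ∈ L → ψ ∈ L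
  substitution : ∀ (s : ℕ → Formula) (φ), φ ∈ L → φ.subst s ∈ L
  necessitation : ∀ φ, φ ∈ L → Formula.box φ ∈ L
  axiomK_mem : Formula.axiomK ∈ L

/-- The type of normal (unimodal) logics, partially ordered by inclusion. -/
abbrev NormalLogic : Type := {L : Set Formula // IsNormalLogic L}

/-- A logic is consistent if it does not contain `⊥`. -/
def IsConsistent (L : NormalLogic) : Prop := Formula.bot ∉ L.1

/-- `⟨L₁, L₂⟩` is a splitting pair: every normal modal logic is either included in `L₁` or
includes `L₂`, but not both. -/
def IsSplittingPair (L₁ L₂ : NormalLogic) : Prop :=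
  ∀ L : NormalLogic, (L ≤ L₁ ∨ L₂ ≤ L) ∧ ¬ (L ≤ L₁ ∧ L₂ ≤ L)

/-- `L₂` is a splitting of the lattice of normal modal logics. -/
def IsSplitting (L₂ : NormalLogic) : Prop :=
  ∃ L₁ : NormalLogic, IsSplittingPair L₁ L₂

/-- `L` is a join-splitting: it is the join (the smallest normal modal logic that includes all
members) of a (possibly empty) family of splittings. -/
def IsJoinSplitting (L : NormalLogic) : Prop :=
  ∃ S : Set NormalLogic, (∀ M ∈ S, IsSplitting M) ∧ IsLUB S L

/-- Modal algebras: Boolean algebras with one unary operator `dia`, which preserves finite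
joins, including the empty one. -/
class ModalAlgebra (A : Type u) extends BooleanAlgebra A where
  dia : A → A
  dia_bot : dia ⊥ = ⊥
  dia_sup : ∀ a b : A, dia (a ⊔ b) = dia a ⊔ dia b

namespace ModalAlgebra

variable (A : Type u) [ModalAlgebra A]

/-- Complete additivity: `dia` preserves all joins that exist in `A`. -/
def IsCompletelyAdditive : Prop :=
  ∀ (X : Set A) (a : A), IsLUB X a → IsLUB (dia '' X) (dia a)

/-- The value of a formula in `A` under an assignment `θ` of elements of `A` to the variables. -/
def eval {A : Type u} [ModalAlgebra A] (θ : ℕ → A) : Formula → A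
  | .var n => θ n
  | .bot => ⊥
  | .imp φ ψ => (eval θ φ)ᶜ ⊔ eval θ ψ
  | .box φ => (dia (eval θ φ)ᶜ)ᶜ

/-- `A` validates `φ`: every assignment sends `φ` to the top element. -/
def Validates (φ : Formula) : Prop := ∀ θ : ℕ → A, eval θ φ = ⊤

/-- The logic `L` is valid over `A`. -/
def ValidatesLogic (L : NormalLogic) : Prop := ∀ φ ∈ L.1, Validates A φ

end ModalAlgebra

/-- `L` and `L'` are valid over exactly the same completely additive modal algebras. -/
def SameVBAOs (L L' : NormalLogic) : Prop :=
  ∀ (A : Type u) [ModalAlgebra A], ModalAlgebra.IsCompletelyAdditive A →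
    (ModalAlgebra.ValidatesLogic A L ↔ ModalAlgebra.ValidatesLogic A L')

/-- The degree of `V`-incompleteness of `L`: the cardinality of the set of all normal modal logics
that are valid over the same completely additive modal algebras as `L`. -/
noncomputable def degreeVIncompleteness (L : NormalLogic) : Cardinal.{0} :=
  Cardinal.mk {L' : NormalLogic // SameVBAOs.{u} L L'}

end ModalLogic

/-! The language is countable, which gives the upper bound. For the lower bound, each set `I` of
natural numbers yields an algebra `G_I` such that the logics `L ∩ Log(G_I)` are pairwise distinct
and have the same completely additive algebras as `L`.

If `L` is not a join-splitting, some `L₀` contains all splittings below `L` but misses some `φ ∈ L`.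
Finitely generated algebras of finite depth are finite, and an atom of such an algebra gives a
splitting by a diagram formula; hence `L ⊆ L₀ ⊕ □ᵈ⊥` for all `d` (`le_boundDepth_of_splittings`). So
`φ` fails in the canonical frame of `L₀` at a point that starts a path of length `d`, the modal
depth of `φ`. Unravel the frame there and keep the points on paths to level `d`. Their other
successors satisfy some `□ʲ⊥` with `j < d`, and are represented by the Lindenbaum algebra `A` of `L₀
⊕ □ᵈ⊥`, which validates `L`. The truth of `φ` at the root is unchanged (`sat_eval_canonicalVal`),
whatever is attached after level `d`.

What is attached closes a cycle: the last level sees a hub, the hub sees the infinite subsets of a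
chain, all chain points see the last of a row of links, and the links lead back to the root. Some of
these points also see a tip, a one-point frame for `L`. The hub sees the chain but no single point
of it, so a formula of van Benthem's kind holds there that cannot hold in a completely additive
algebra (`eq_bot_of_van_benthem`). As `A` and the tip validate `L`, a disjunction `φ ∨ ψ` lies in `L
∩ Log(G_I)` once `ψ` holds at the remaining points where `φ` fails. With `ψ` expressing the
behaviour of the hub, no completely additive algebra for the intersection refutes a theorem of `L`
(`sameVBAOs_interLogic`). Which chain points see the tip encodes `I` (`subset_of_interLogic_eq`). -/

namespace ModalLogic

/-! ### Modal algebras, iterated modalities and ultrafilters. -/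

namespace ModalAlgebra

section Basic

variable {A : Type*} [ModalAlgebra A]

theorem compl_sup_eq_top_iff {a b : A} : aᶜ ⊔ b = ⊤ ↔ a ≤ b := by
  rw [sup_comm, ← himp_eq, himp_eq_top_iff]

theorem inf_le_iff_le_compl_sup {a b c : A} : a ⊓ b ≤ c ↔ a ≤ bᶜ ⊔ c := by
  rw [sup_comm, ← himp_eq, le_himp_iff]

theorem dia_mono {a b : A} (h : a ≤ b) : dia a ≤ dia b := by
  rw [← sup_eq_right.2 h, dia_sup]
  exact le_sup_left

/-- The dual of `dia`. -/
def nec (a : A) : A := (dia aᶜ)ᶜ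

theorem nec_mono {a b : A} (h : a ≤ b) : nec a ≤ nec b :=
  compl_le_compl (dia_mono (compl_le_compl h))

theorem nec_top : nec (⊤ : A) = ⊤ := by simp [nec, dia_bot]

theorem nec_inf (a b : A) : nec (a ⊓ b) = nec a ⊓ nec b := by
  simp [nec, compl_inf, dia_sup, compl_sup]

theorem compl_nec (a : A) : (nec a)ᶜ = dia aᶜ := by simp [nec]

/-- The elements `⊥, □⊥, □□⊥, …`. -/
def necBot (A : Type*) [ModalAlgebra A] (n : ℕ) : A := nec^[n] ⊥

theorem necBot_zero : necBot A 0 = ⊥ := rfl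

theorem necBot_succ (n : ℕ) : necBot A (n + 1) = nec (necBot A n) :=
  Function.iterate_succ_apply' _ _ _

theorem necBot_le_succ (n : ℕ) : necBot A n ≤ necBot A (n + 1) := by
  induction n with
  | zero => exact bot_le
  | succ n ih => rw [necBot_succ, necBot_succ (n + 1)]; exact nec_mono ih

theorem necBot_mono : Monotone (necBot A) := monotone_nat_of_le_succ necBot_le_succ

/-- The elements `⊤, ◇⊤, ◇◇⊤, …`. -/
def diaTop (A : Type*) [ModalAlgebra A] (n : ℕ) : A := dia^[n] ⊤

theorem diaTop_succ (n : ℕ) : diaTop A (n + 1) = dia (diaTop A n) :=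
  Function.iterate_succ_apply' _ _ _

theorem compl_necBot (n : ℕ) : (necBot A n)ᶜ = diaTop A n := by
  induction n with
  | zero => exact compl_bot
  | succ n ih => rw [necBot_succ, diaTop_succ, compl_nec, ih]

theorem diaTop_succ_le (n : ℕ) : diaTop A (n + 1) ≤ diaTop A n := by
  rw [← compl_necBot, ← compl_necBot]
  exact compl_le_compl (necBot_le_succ n)

/-- What can reach `a` within `n` steps. -/
def reach : ℕ → A → A
  | 0, a => a
  | n + 1, a => a ⊔ dia (reach n a)

theorem reach_mono (n : ℕ) {a b : A} (h : a ≤ b) : reach n a ≤ reach n b := by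
  induction n with
  | zero => exact h
  | succ n ih => exact sup_le_sup h (dia_mono ih)

theorem reach_bot (n : ℕ) : reach n (⊥ : A) = ⊥ := by
  induction n with
  | zero => rfl
  | succ n ih => simp [reach, ih, dia_bot]

theorem le_reach (n : ℕ) (a : A) : a ≤ reach n a := by
  cases n with
  | zero => exact le_rfl
  | succ n => exact le_sup_left

theorem reach_le_succ (n : ℕ) (a : A) : reach n a ≤ reach (n + 1) a := by
  induction n with
  | zero => exact le_sup_left
  | succ n ih => exact sup_le_sup le_rfl (dia_mono ih)

theorem reach_le_of_le {m n : ℕ} (h : m ≤ n) (a : A) : reach m a ≤ reach n a :=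
  monotone_nat_of_le_succ (f := fun n => reach n a) (fun n => reach_le_succ n a) h

theorem dia_le_reach (n : ℕ) (a b : A) (h : b ≤ reach n a) : dia b ≤ reach (n + 1) a :=
  (dia_mono h).trans le_sup_right

theorem reach_reach (m n : ℕ) (a b : A) (h : b ≤ reach n a) : reach m b ≤ reach (m + n) a := by
  induction m with
  | zero => simpa [reach] using h
  | succ m ih =>
    refine sup_le (h.trans (reach_le_of_le (by omega) a)) ?_
    rw [Nat.succ_add]
    exact dia_le_reach _ _ _ ih

section Eval

variable (θ : ℕ → A) (φ ψ : Formula)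

@[simp] theorem eval_var (n : ℕ) : eval θ (.var n) = θ n := rfl
@[simp] theorem eval_bot : eval θ .bot = ⊥ := rfl
@[simp] theorem eval_imp : eval θ (.imp φ ψ) = (eval θ φ)ᶜ ⊔ eval θ ψ := rfl
@[simp] theorem eval_box : eval θ (.box φ) = nec (eval θ φ) := rfl
@[simp] theorem eval_neg : eval θ φ.neg = (eval θ φ)ᶜ := by simp [Formula.neg]
@[simp] theorem eval_top : eval θ .top = ⊤ := by simp [Formula.top]
@[simp] theorem eval_or : eval θ (φ.or ψ) = eval θ φ ⊔ eval θ ψ := by simp [Formula.or]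
@[simp] theorem eval_and : eval θ (φ.and ψ) = eval θ φ ⊓ eval θ ψ := by simp [Formula.and]
@[simp] theorem eval_dia : eval θ φ.dia = dia (eval θ φ) := by simp [Formula.dia, nec]

theorem eval_subst (s : ℕ → Formula) :
    eval θ (φ.subst s) = eval (fun n => eval θ (s n)) φ := by
  induction φ with
  | var n => rfl
  | bot => rfl
  | imp φ ψ h₁ h₂ => simp [Formula.subst, h₁, h₂]
  | box φ h => simp [Formula.subst, h]

end Eval

/-- Ultrafilters of a modal algebra. -/
structure IsPoint (U : Set A) : Prop where
  sup_mem : ∀ a b, a ⊔ b ∈ U ↔ a ∈ U ∨ b ∈ U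
  compl_mem : ∀ a, aᶜ ∈ U ↔ a ∉ U

namespace IsPoint

variable {U : Set A}

theorem top_mem (hU : IsPoint U) : (⊤ : A) ∈ U := by
  rw [← sup_compl_eq_top (x := (⊤ : A)), hU.sup_mem, hU.compl_mem]
  exact em _

theorem bot_notMem (hU : IsPoint U) : (⊥ : A) ∉ U := by
  rw [← hU.compl_mem, compl_bot]
  exact hU.top_mem

theorem mem_of_le (hU : IsPoint U) {a b : A} (h : a ≤ b) (ha : a ∈ U) : b ∈ U := by
  rw [← sup_eq_right.2 h, hU.sup_mem]
  exact Or.inl ha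

theorem inf_mem (hU : IsPoint U) (a b : A) : a ⊓ b ∈ U ↔ a ∈ U ∧ b ∈ U := by
  have h := hU.compl_mem (aᶜ ⊔ bᶜ)
  rw [compl_sup, compl_compl, compl_compl, hU.sup_mem, hU.compl_mem, hU.compl_mem] at h
  rw [h]
  tauto

end IsPoint

/-- An element outside an ideal belongs to an ultrafilter disjoint from the ideal. -/
theorem exists_isPoint (I : Set A) (hbot : ⊥ ∈ I) (hsup : ∀ a b, a ∈ I → b ∈ I → a ⊔ b ∈ I)
    (hle : ∀ a b, a ≤ b → b ∈ I → a ∈ I) {a : A} (ha : a ∉ I) :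
    ∃ U : Set A, IsPoint U ∧ a ∈ U ∧ ∀ b ∈ U, b ∉ I := by
  let J : Order.Ideal A :=
    { carrier := I
      lower' := fun b c hcb hb => hle c b hcb hb
      nonempty' := ⟨⊥, hbot⟩
      directed' := fun b hb c hc => ⟨b ⊔ c, hsup b c hb hc, le_sup_left, le_sup_right⟩ }
  have hdisj : Disjoint (Order.PFilter.principal a : Set A) (J : Set A) := by
    rw [Set.disjoint_left]
    intro b hb hbJ
    exact ha (hle a b (Order.PFilter.mem_principal.1 hb) hbJ)
  obtain ⟨P, hP, hJP, hFP⟩ := DistribLattice.prime_ideal_of_disjoint_filter_ideal hdisj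
  refine ⟨{b | b ∉ P}, ⟨fun b c => ?_, fun b => ?_⟩, ?_, fun b hb hbI => hb (hJP hbI)⟩
  · simp only [Set.mem_ofPred_eq, Order.Ideal.sup_mem_iff]
    tauto
  · simp only [Set.mem_ofPred_eq, not_not]
    constructor
    · intro h
      exact (hP.mem_or_compl_mem).resolve_right h
    · intro h h'
      apply hP.toIsProper.top_notMem
      rw [← sup_compl_eq_top (x := b)]
      exact Order.Ideal.sup_mem h h'
  · exact Set.disjoint_left.1 hFP (Order.PFilter.mem_principal.2 le_rfl)

theorem exists_isPoint_mem {a : A} (ha : a ≠ ⊥) : ∃ U : Set A, IsPoint U ∧ a ∈ U := by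
  obtain ⟨U, hU, haU, -⟩ := exists_isPoint {(⊥ : A)} rfl (by rintro _ _ rfl rfl; simp)
    (by rintro b _ h rfl; exact le_bot_iff.1 h) ha
  exact ⟨U, hU, haU⟩

/-- The canonical accessibility relation between ultrafilters. -/
def Sees (U V : Set A) : Prop := ∀ a ∈ V, dia a ∈ U

theorem exists_sees {U : Set A} (hU : IsPoint U) {a : A} (ha : dia a ∈ U) :
    ∃ V : Set A, IsPoint V ∧ Sees U V ∧ a ∈ V := by
  -- An ultrafilter is seen from `U` exactly if it avoids the ideal of elements whose diamond is not
  -- in `U`.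
  obtain ⟨V, hV, haV, h⟩ := exists_isPoint {b : A | dia b ∉ U}
    (by simpa [dia_bot] using hU.bot_notMem)
    (fun b c hb hc => by
      simp only [Set.mem_ofPred_eq, dia_sup, hU.sup_mem] at *
      tauto)
    (fun b c hbc hc hb => hc (hU.mem_of_le (dia_mono hbc) hb)) (not_not.2 ha)
  exact ⟨V, hV, fun b hb => not_not.1 (h b hb), haV⟩

/-- Membership of values in an ultrafilter is a classical valuation that treats boxed formulas as
atoms. -/
theorem eval_eq_top_of_isTautology {φ : Formula} (hφ : φ.IsTautology) (θ : ℕ → A) :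
    eval θ φ = ⊤ := by
  by_contra h
  obtain ⟨U, hU, hmem⟩ := exists_isPoint_mem (mt compl_eq_bot.1 h)
  have key : ∀ ψ : Formula, ψ.Truth (fun χ => eval θ χ ∈ U) ↔ eval θ ψ ∈ U := by
    intro ψ
    induction ψ with
    | var n => rfl
    | bot => simpa [Formula.Truth] using hU.bot_notMem
    | imp ψ χ h₁ h₂ =>
      simp only [Formula.Truth, h₁, h₂, eval_imp, hU.sup_mem, hU.compl_mem]
      tauto
    | box ψ _ => rfl
  exact (hU.compl_mem _).1 hmem ((key φ).1 (hφ _))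

end Basic

/-- The logic of a modal algebra is normal. -/
theorem isNormalLogic_validates (A : Type*) [ModalAlgebra A] :
    IsNormalLogic {φ | Validates A φ} where
  tautology _ h θ := eval_eq_top_of_isTautology h θ
  modusPonens φ ψ h₁ h₂ θ := by simpa [h₁ θ] using h₂ θ
  substitution s φ h θ := by rw [eval_subst]; exact h _
  necessitation φ h θ := by rw [eval_box, h θ, nec_top]
  axiomK_mem θ := by
    simp only [Formula.axiomK, eval_imp, eval_box, eval_var]
    rw [compl_sup_eq_top_iff, ← inf_le_iff_le_compl_sup, ← nec_inf]
    exact nec_mono (inf_le_iff_le_compl_sup.2 le_rfl)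

end ModalAlgebra

/-! ### Theories and their Lindenbaum algebras. -/

open ModalAlgebra

/-- Sets of formulas closed under the rules of normal logics, except for substitution. -/
structure IsTheory (T : Set Formula) : Prop where
  tautology : ∀ φ, φ.IsTautology → φ ∈ T
  modusPonens : ∀ φ ψ, φ ∈ T → Formula.imp φ ψ ∈ T → ψ ∈ T
  necessitation : ∀ φ, φ ∈ T → Formula.box φ ∈ T
  box_imp_mem : ∀ φ ψ : Formula, ((φ.imp ψ).box.imp (φ.box.imp ψ.box)) ∈ T

theorem IsNormalLogic.isTheory {L : Set Formula} (h : IsNormalLogic L) : IsTheory L where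
  tautology := h.tautology
  modusPonens := h.modusPonens
  necessitation := h.necessitation
  box_imp_mem φ ψ := h.substitution (fun n => if n = 0 then φ else ψ) _ h.axiomK_mem

namespace IsTheory

variable {T : Set Formula}

theorem mem_of_imp (hT : IsTheory T) {φ ψ : Formula} (h : (φ.imp ψ).IsTautology) (hφ : φ ∈ T) :
    ψ ∈ T :=
  hT.modusPonens _ _ hφ (hT.tautology _ h)

theorem mem_of_imp_imp (hT : IsTheory T) {φ ψ χ : Formula}
    (h : (φ.imp (ψ.imp χ)).IsTautology) (hφ : φ ∈ T) (hψ : ψ ∈ T) : χ ∈ T :=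
  hT.modusPonens _ _ hψ (hT.mem_of_imp h hφ)

theorem trans_mem (hT : IsTheory T) {φ ψ χ : Formula} (h₁ : φ.imp ψ ∈ T) (h₂ : ψ.imp χ ∈ T) :
    φ.imp χ ∈ T :=
  hT.mem_of_imp_imp (fun v => by simp only [Formula.Truth]; tauto) h₁ h₂

theorem box_mono_mem (hT : IsTheory T) {φ ψ : Formula} (h : φ.imp ψ ∈ T) :
    φ.box.imp ψ.box ∈ T :=
  hT.modusPonens _ _ (hT.necessitation _ h) (hT.box_imp_mem φ ψ)

theorem neg_mono_mem (hT : IsTheory T) {φ ψ : Formula} (h : φ.imp ψ ∈ T) :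
    ψ.neg.imp φ.neg ∈ T :=
  hT.mem_of_imp (fun v => by simp only [Formula.Truth, Formula.neg]; tauto) h

theorem dia_mono_mem (hT : IsTheory T) {φ ψ : Formula} (h : φ.imp ψ ∈ T) :
    φ.dia.imp ψ.dia ∈ T :=
  hT.neg_mono_mem (hT.box_mono_mem (hT.neg_mono_mem h))

theorem dia_or_mem (hT : IsTheory T) (φ ψ : Formula) :
    (φ.or ψ).dia.imp (φ.dia.or ψ.dia) ∈ T := by
  have h₁ : φ.neg.box.imp (ψ.neg.imp (φ.or ψ).neg).box ∈ T := hT.box_mono_mem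
    (hT.tautology _ fun v => by simp only [Formula.Truth, Formula.neg, Formula.or]; tauto)
  have h₂ := hT.trans_mem h₁ (hT.box_imp_mem _ _)
  exact hT.mem_of_imp
    (fun v => by simp only [Formula.Truth, Formula.neg, Formula.or, Formula.dia]; tauto) h₂

/-- Provable equivalence. -/
def setoid (hT : IsTheory T) : Setoid Formula where
  r φ ψ := φ.imp ψ ∈ T ∧ ψ.imp φ ∈ T
  iseqv :=
    { refl := fun _ => ⟨hT.tautology _ fun _ => id, hT.tautology _ fun _ => id⟩
      symm := fun h => ⟨h.2, h.1⟩
      trans := fun h₁ h₂ => ⟨hT.trans_mem h₁.1 h₂.1, hT.trans_mem h₂.2 h₁.2⟩ }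

/-- The Lindenbaum algebra of a theory. -/
def Lind (hT : IsTheory T) : Type := Quotient hT.setoid

namespace Lind

/-- The class of a formula. -/
def mk (hT : IsTheory T) (φ : Formula) : hT.Lind := Quotient.mk hT.setoid φ

variable (hT : IsTheory T)

theorem mk_surjective (a : hT.Lind) : ∃ φ, mk hT φ = a := Quotient.exists_rep a

instance : LE hT.Lind where
  le := Quotient.lift₂ (fun φ ψ => φ.imp ψ ∈ T) fun _ _ _ _ h₁ h₂ => propext
    ⟨fun h => hT.trans_mem h₁.2 (hT.trans_mem h h₂.1),
      fun h => hT.trans_mem h₁.1 (hT.trans_mem h h₂.2)⟩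

theorem mk_le_mk {φ ψ : Formula} : mk hT φ ≤ mk hT ψ ↔ φ.imp ψ ∈ T := Iff.rfl

theorem mk_eq_mk {φ ψ : Formula} : mk hT φ = mk hT ψ ↔ φ.imp ψ ∈ T ∧ ψ.imp φ ∈ T :=
  ⟨fun h => Quotient.exact h, fun h => Quotient.sound h⟩

instance : PartialOrder hT.Lind where
  le_refl := by rintro ⟨φ⟩; exact hT.tautology _ fun v => id
  le_trans := by rintro ⟨φ⟩ ⟨ψ⟩ ⟨χ⟩ h₁ h₂; exact hT.trans_mem h₁ h₂
  le_antisymm := by rintro ⟨φ⟩ ⟨ψ⟩ h₁ h₂; exact Quotient.sound ⟨h₁, h₂⟩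

instance : Lattice hT.Lind where
  sup := Quotient.map₂ Formula.or fun φ φ' h₁ ψ ψ' h₂ =>
    ⟨hT.mem_of_imp_imp (fun v => by simp only [Formula.Truth, Formula.neg, Formula.or]; tauto)
      h₁.1 h₂.1,
     hT.mem_of_imp_imp (fun v => by simp only [Formula.Truth, Formula.neg, Formula.or]; tauto)
      h₁.2 h₂.2⟩
  inf := Quotient.map₂ Formula.and fun φ φ' h₁ ψ ψ' h₂ =>
    ⟨hT.mem_of_imp_imp (fun v => by simp only [Formula.Truth, Formula.neg, Formula.and]; tauto)
      h₁.1 h₂.1,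
     hT.mem_of_imp_imp (fun v => by simp only [Formula.Truth, Formula.neg, Formula.and]; tauto)
      h₁.2 h₂.2⟩
  le_sup_left := by
    rintro ⟨φ⟩ ⟨ψ⟩
    exact hT.tautology _ fun v => by simp only [Formula.Truth, Formula.neg, Formula.or]; tauto
  le_sup_right := by
    rintro ⟨φ⟩ ⟨ψ⟩
    exact hT.tautology _ fun v => by simp only [Formula.Truth, Formula.neg, Formula.or]; tauto
  sup_le := by
    rintro ⟨φ⟩ ⟨ψ⟩ ⟨χ⟩ h₁ h₂
    exact hT.mem_of_imp_imp
      (fun v => by simp only [Formula.Truth, Formula.neg, Formula.or]; tauto) h₁ h₂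
  inf_le_left := by
    rintro ⟨φ⟩ ⟨ψ⟩
    exact hT.tautology _ fun v => by simp only [Formula.Truth, Formula.neg, Formula.and]; tauto
  inf_le_right := by
    rintro ⟨φ⟩ ⟨ψ⟩
    exact hT.tautology _ fun v => by simp only [Formula.Truth, Formula.neg, Formula.and]; tauto
  le_inf := by
    rintro ⟨φ⟩ ⟨ψ⟩ ⟨χ⟩ h₁ h₂
    exact hT.mem_of_imp_imp
      (fun v => by simp only [Formula.Truth, Formula.neg, Formula.and]; tauto) h₁ h₂

instance : BooleanAlgebra hT.Lind where
  le_sup_inf := by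
    rintro ⟨φ⟩ ⟨ψ⟩ ⟨χ⟩
    exact hT.tautology _ fun v => by
      simp only [Formula.Truth, Formula.neg, Formula.and, Formula.or]; tauto
  compl := Quotient.map Formula.neg fun φ ψ h => ⟨hT.neg_mono_mem h.2, hT.neg_mono_mem h.1⟩
  top := mk hT .top
  bot := mk hT .bot
  inf_compl_le_bot := by
    rintro ⟨φ⟩
    exact hT.tautology _ fun v => by simp only [Formula.Truth, Formula.neg, Formula.and]; tauto
  top_le_sup_compl := by
    rintro ⟨φ⟩
    exact hT.tautology _ fun v => by simp only [Formula.Truth, Formula.neg, Formula.or]; tauto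
  le_top := by
    rintro ⟨φ⟩
    exact hT.tautology _ fun v => by simp only [Formula.Truth, Formula.neg, Formula.top]; tauto
  bot_le := by
    rintro ⟨φ⟩
    exact hT.tautology _ fun v => by simp only [Formula.Truth]; tauto

instance : ModalAlgebra hT.Lind where
  dia := Quotient.map Formula.dia fun φ ψ h => ⟨hT.dia_mono_mem h.1, hT.dia_mono_mem h.2⟩
  dia_bot := by
    refine (mk_eq_mk hT).2 ⟨?_, hT.tautology _ fun v => by simp only [Formula.Truth]; tauto⟩
    exact hT.mem_of_imp (φ := Formula.box (Formula.neg .bot))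
      (fun v => by simp only [Formula.Truth, Formula.neg, Formula.dia]; tauto)
      (hT.necessitation _ (hT.tautology _ fun v => id))
  dia_sup := by
    rintro ⟨φ⟩ ⟨ψ⟩
    have h₁ : φ.dia.imp (φ.or ψ).dia ∈ T := hT.dia_mono_mem
      (hT.tautology _ fun v => by simp only [Formula.Truth, Formula.neg, Formula.or]; tauto)
    have h₂ : ψ.dia.imp (φ.or ψ).dia ∈ T := hT.dia_mono_mem
      (hT.tautology _ fun v => by simp only [Formula.Truth, Formula.neg, Formula.or]; tauto)
    exact (mk_eq_mk hT).2 ⟨hT.dia_or_mem φ ψ, hT.mem_of_imp_imp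
      (fun v => by simp only [Formula.Truth, Formula.neg, Formula.or]; tauto) h₁ h₂⟩

theorem mk_bot : mk hT .bot = ⊥ := rfl

theorem mk_imp (φ ψ : Formula) : mk hT (φ.imp ψ) = (mk hT φ)ᶜ ⊔ mk hT ψ :=
  (mk_eq_mk hT).2
    ⟨hT.tautology _ fun v => by simp only [Formula.Truth, Formula.neg]; tauto,
     hT.tautology _ fun v => by simp only [Formula.Truth, Formula.neg]; tauto⟩

theorem mk_box (φ : Formula) : mk hT φ.box = nec (mk hT φ) := by
  have h : φ.neg.neg.box.imp φ.box ∈ T := hT.box_mono_mem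
    (hT.tautology _ fun v => by simp only [Formula.Truth, Formula.neg]; tauto)
  have h' : φ.box.imp φ.neg.neg.box ∈ T := hT.box_mono_mem
    (hT.tautology _ fun v => by simp only [Formula.Truth, Formula.neg]; tauto)
  exact (mk_eq_mk hT).2
    ⟨hT.mem_of_imp (fun v => by simp only [Formula.Truth, Formula.neg, Formula.dia]; tauto) h',
     hT.mem_of_imp (fun v => by simp only [Formula.Truth, Formula.neg, Formula.dia]; tauto) h⟩

theorem mk_eq_top {φ : Formula} : mk hT φ = ⊤ ↔ φ ∈ T := by
  rw [← top_le_iff]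
  constructor
  · intro h
    exact hT.modusPonens _ _ (hT.tautology _ fun v => id) h
  · intro h
    exact hT.mem_of_imp (fun v => by simp only [Formula.Truth]; tauto) h

theorem eval_mk (s : ℕ → Formula) (φ : Formula) :
    eval (fun n => mk hT (s n)) φ = mk hT (φ.subst s) := by
  induction φ with
  | var n => rfl
  | bot => rfl
  | imp φ ψ h₁ h₂ => rw [eval_imp, h₁, h₂, Formula.subst, mk_imp]
  | box φ h => rw [eval_box, h, Formula.subst, mk_box]

theorem validates_of_subst_mem {φ : Formula} (h : ∀ s, φ.subst s ∈ T) : Validates hT.Lind φ := by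
  intro θ
  choose s hs using fun n => mk_surjective hT (θ n)
  obtain rfl : (fun n => mk hT (s n)) = θ := funext hs
  rw [eval_mk, mk_eq_top]
  exact h s

theorem eval_mk_var (φ : Formula) : eval (fun n => mk hT (.var n)) φ = mk hT φ := by
  induction φ with
  | var n => rfl
  | bot => rfl
  | imp φ ψ h₁ h₂ => rw [eval_imp, h₁, h₂, mk_imp]
  | box φ h => rw [eval_box, h, mk_box]

end Lind

end IsTheory

/-- The smallest normal logic that includes a set of formulas. -/
def normalClosure (Γ : Set Formula) : NormalLogic :=
  ⟨{φ | ∀ L : NormalLogic, Γ ⊆ L.1 → φ ∈ L.1},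
    { tautology := fun φ h L _ => L.2.tautology φ h
      modusPonens := fun φ ψ h₁ h₂ L hL => L.2.modusPonens φ ψ (h₁ L hL) (h₂ L hL)
      substitution := fun s φ h L hL => L.2.substitution s φ (h L hL)
      necessitation := fun φ h L hL => L.2.necessitation φ (h L hL)
      axiomK_mem := fun L _ => L.2.axiomK_mem }⟩

theorem subset_normalClosure (Γ : Set Formula) : Γ ⊆ (normalClosure Γ).1 :=
  fun _ hφ _ hL => hL hφ

theorem normalClosure_le {Γ : Set Formula} {L : NormalLogic} (h : Γ ⊆ L.1) :
    normalClosure Γ ≤ L :=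
  fun _ hφ => hφ L h

/-- The Lindenbaum algebra of a normal logic validates the logic. -/
theorem validatesLogic_lind (L : NormalLogic) : ValidatesLogic L.2.isTheory.Lind L :=
  fun φ hφ => IsTheory.Lind.validates_of_subst_mem _ fun s => L.2.substitution s φ hφ

/-! ### Diagram formulas and splittings. -/

namespace ModalAlgebra

section Congruence

variable {M : Type*} [ModalAlgebra M] {δ x x' y y' : M}

theorem inf_eq_inf_of_le_iff (h : δ ≤ (xᶜ ⊔ y) ⊓ (yᶜ ⊔ x)) : δ ⊓ x = δ ⊓ y := by
  have h₁ := inf_le_iff_le_compl_sup.2 (h.trans inf_le_left)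
  have h₂ := inf_le_iff_le_compl_sup.2 (h.trans inf_le_right)
  exact le_antisymm (le_inf inf_le_left h₁) (le_inf inf_le_left h₂)

theorem inf_compl_le_of_inf_eq (h : δ ⊓ x = δ ⊓ x') : δ ⊓ xᶜ ≤ x'ᶜ := by
  rw [le_compl_iff_disjoint_right, disjoint_iff, inf_right_comm, ← h, inf_assoc, inf_compl_self,
    inf_bot_eq]

theorem inf_compl_congr (h : δ ⊓ x = δ ⊓ x') : δ ⊓ xᶜ = δ ⊓ x'ᶜ :=
  le_antisymm (le_inf inf_le_left (inf_compl_le_of_inf_eq h))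
    (le_inf inf_le_left (inf_compl_le_of_inf_eq h.symm))

theorem inf_imp_congr (h : δ ⊓ x = δ ⊓ x') (h' : δ ⊓ y = δ ⊓ y') :
    δ ⊓ (xᶜ ⊔ y) = δ ⊓ (x'ᶜ ⊔ y') := by
  rw [inf_sup_left, inf_sup_left, inf_compl_congr h, h']

theorem inf_nec_congr (hδ : δ ≤ nec δ) (h : δ ⊓ x = δ ⊓ x') : δ ⊓ nec x = δ ⊓ nec x' := by
  have key : ∀ {u v : M}, δ ⊓ u = δ ⊓ v → δ ⊓ nec u ≤ nec v := fun {u v} huv => calc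
    δ ⊓ nec u ≤ nec δ ⊓ nec u := inf_le_inf_right _ hδ
    _ = nec (δ ⊓ v) := by rw [← nec_inf, huv]
    _ ≤ nec v := nec_mono inf_le_right
  exact le_antisymm (le_inf inf_le_left (key h)) (le_inf inf_le_left (key h.symm))

/-- A map that respects the operations modulo `δ` commutes with the evaluation of formulas
modulo `δ`. -/
theorem inf_eval_comp {A : Type*} [ModalAlgebra A] (f : A → M) (hδ : δ ≤ nec δ)
    (hbot : δ ⊓ f ⊥ = ⊥) (himp : ∀ a b, δ ⊓ f (aᶜ ⊔ b) = δ ⊓ ((f a)ᶜ ⊔ f b))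
    (hnec : ∀ a, δ ⊓ f (nec a) = δ ⊓ nec (f a)) (θ : ℕ → A) (ψ : Formula) :
    δ ⊓ eval (fun n => f (θ n)) ψ = δ ⊓ f (eval θ ψ) := by
  induction ψ with
  | var n => rfl
  | bot => simp [hbot]
  | imp φ ψ h₁ h₂ => rw [eval_imp, eval_imp, himp, inf_imp_congr h₁ h₂]
  | box φ h => rw [eval_box, eval_box, hnec, inf_nec_congr hδ h]

end Congruence

section RootLogic

variable {A : Type*} [ModalAlgebra A]

theorem nec_iterate_top (n : ℕ) : nec^[n] (⊤ : A) = ⊤ := by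
  induction n with
  | zero => rfl
  | succ n ih => rw [Function.iterate_succ_apply, nec_top, ih]

theorem nec_iterate_inf (n : ℕ) (a b : A) : nec^[n] (a ⊓ b) = nec^[n] a ⊓ nec^[n] b := by
  induction n generalizing a b with
  | zero => rfl
  | succ n ih => simp only [Function.iterate_succ_apply, nec_inf, ih]

theorem nec_iterate_mono (n : ℕ) {a b : A} (h : a ≤ b) : nec^[n] a ≤ nec^[n] b := by
  rw [← inf_eq_left.2 h, nec_iterate_inf]
  exact inf_le_right

/-- The logic of the part of an algebra that is accessible from `r`. -/
def rootLogic (r : A) : NormalLogic :=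
  ⟨{φ | ∀ (θ : ℕ → A) (n : ℕ), r ≤ nec^[n] (eval θ φ)},
    { tautology := fun φ h θ n => by simp [eval_eq_top_of_isTautology h, nec_iterate_top]
      modusPonens := fun φ ψ h₁ h₂ θ n => by
        refine (le_inf (h₁ θ n) (h₂ θ n)).trans ?_
        rw [← nec_iterate_inf, eval_imp]
        apply nec_iterate_mono
        rw [inf_sup_left, inf_compl_self, bot_sup_eq]
        exact inf_le_right
      substitution := fun s φ h θ n => by rw [eval_subst]; exact h _ n
      necessitation := fun φ h θ n => h θ (n + 1)
      axiomK_mem := fun θ n => by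
        rw [(isNormalLogic_validates A).axiomK_mem θ, nec_iterate_top]
        exact le_top }⟩

end RootLogic

end ModalAlgebra

namespace Formula

/-- Conjunction of a list of formulas. -/
def all : List Formula → Formula
  | [] => top
  | φ :: l => φ.and (all l)

/-- Biconditional. -/
def iff (φ ψ : Formula) : Formula := (φ.imp ψ).and (ψ.imp φ)

/-- `hereditarily φ n` says that `φ` holds throughout the part of the model accessible from the
current point and that this part has depth less than `n`. -/
def hereditarily (φ : Formula) : ℕ → Formula
  | 0 => bot
  | n + 1 => φ.and (hereditarily φ n).box

/-- The diagram of a finite modal algebra, whose elements are named by variables. -/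
noncomputable def diagram (A : Type*) [ModalAlgebra A] [Fintype A] (e : A → ℕ) : Formula :=
  all (((var (e ⊥)).neg ::
    (Finset.univ : Finset A).toList.map (fun a => (var (e (nec a))).iff (var (e a)).box)) ++
    (Finset.univ : Finset (A × A)).toList.map
      (fun p => (var (e (p.1ᶜ ⊔ p.2))).iff ((var (e p.1)).imp (var (e p.2)))))

end Formula

namespace ModalAlgebra

section Diagram

variable {M : Type*} [ModalAlgebra M] (θ : ℕ → M)

theorem eval_all_le {l : List Formula} {φ : Formula} (h : φ ∈ l) :
    eval θ (.all l) ≤ eval θ φ := by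
  induction l with
  | nil => cases h
  | cons ψ l ih =>
    rw [Formula.all, eval_and]
    rcases List.mem_cons.1 h with rfl | h
    · exact inf_le_left
    · exact inf_le_right.trans (ih h)

theorem eval_all_eq_top {l : List Formula} (h : ∀ φ ∈ l, eval θ φ = ⊤) :
    eval θ (.all l) = ⊤ := by
  induction l with
  | nil => simp [Formula.all]
  | cons ψ l ih =>
    rw [Formula.all, eval_and, h ψ (by simp), ih fun φ hφ => h φ (by simp [hφ]), inf_top_eq]

@[simp] theorem eval_iff (φ ψ : Formula) : eval θ (φ.iff ψ) =
    ((eval θ φ)ᶜ ⊔ eval θ ψ) ⊓ ((eval θ ψ)ᶜ ⊔ eval θ φ) := by simp [Formula.iff]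

theorem eval_hereditarily_le (φ : Formula) (n : ℕ) :
    eval θ (φ.hereditarily n) ≤ eval θ φ := by
  cases n with
  | zero => exact bot_le
  | succ n => simp [Formula.hereditarily]

theorem eval_hereditarily_le_succ (φ : Formula) (n : ℕ) :
    eval θ (φ.hereditarily n) ≤ eval θ (φ.hereditarily (n + 1)) := by
  induction n with
  | zero => exact bot_le
  | succ n ih =>
    rw [Formula.hereditarily, Formula.hereditarily, eval_and, eval_and, eval_box, eval_box]
    exact inf_le_inf_left _ (nec_mono ih)

theorem eval_hereditarily_le_nec (φ : Formula) (n : ℕ) :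
    eval θ (φ.hereditarily n) ≤ nec (eval θ (φ.hereditarily n)) := by
  refine (eval_hereditarily_le_succ θ φ n).trans ?_
  simp [Formula.hereditarily]

theorem eval_hereditarily_of_eq_top {φ : Formula} (h : eval θ φ = ⊤) (n : ℕ) :
    eval θ (φ.hereditarily n) = necBot M n := by
  induction n with
  | zero => rfl
  | succ n ih => rw [Formula.hereditarily, eval_and, h, eval_box, ih, necBot_succ, top_inf_eq]

variable {A : Type*} [ModalAlgebra A] [Fintype A] {e : A → ℕ}

theorem eval_diagram_eq_top {θ : ℕ → A} (hθ : ∀ a, θ (e a) = a) :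
    eval θ (.diagram A e) = ⊤ := by
  refine eval_all_eq_top θ fun φ hφ => ?_
  simp only [List.cons_append, List.mem_cons, List.mem_append, List.mem_map, Finset.mem_toList,
    Finset.mem_univ, true_and] at hφ
  rcases hφ with rfl | ⟨a, rfl⟩ | ⟨p, rfl⟩
  · simp [hθ]
  · simp [hθ]
  · rw [eval_iff]
    simp only [eval_imp, eval_var, hθ, compl_sup_eq_top, inf_top_eq]

/-- The conjuncts of the diagram are what `inf_eval_comp` asks for: below `δ`, naming elements of
`A` by variables is a homomorphism. -/
theorem inf_eval_diagram {θ : ℕ → M} {δ : M} (hδ : δ ≤ nec δ)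
    (h : δ ≤ eval θ (.diagram A e)) (η : ℕ → A) (ψ : Formula) :
    δ ⊓ eval (fun n => θ (e (η n))) ψ = δ ⊓ θ (e (eval η ψ)) := by
  refine inf_eval_comp (fun a => θ (e a)) hδ ?_ (fun a b => ?_) (fun a => ?_) η ψ
  · have := h.trans (eval_all_le θ (φ := (Formula.var (e ⊥)).neg) (by simp))
    rw [eval_neg, eval_var, le_compl_iff_disjoint_right] at this
    exact this.eq_bot
  · have := h.trans (eval_all_le θ (φ := (Formula.var (e (aᶜ ⊔ b))).iff
      ((Formula.var (e a)).imp (.var (e b)))) (List.mem_append_right _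
        (List.mem_map.2 ⟨(a, b), by simp, rfl⟩)))
    rw [eval_iff] at this
    exact inf_eq_inf_of_le_iff this
  · have := h.trans (eval_all_le θ (φ := (Formula.var (e (nec a))).iff (Formula.var (e a)).box)
      (List.mem_append_left _ (List.mem_cons_of_mem _ (List.mem_map.2 ⟨a, by simp, rfl⟩))))
    rw [eval_iff] at this
    exact inf_eq_inf_of_le_iff this

end Diagram

theorem eval_nec_iterate {M : Type*} [ModalAlgebra M] (θ : ℕ → M) (φ : Formula) (n : ℕ) :
    eval θ (Formula.box^[n] φ) = nec^[n] (eval θ φ) := by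
  induction n with
  | zero => rfl
  | succ n ih => rw [Function.iterate_succ_apply', Function.iterate_succ_apply', eval_box, ih]

end ModalAlgebra

/-- The part of a finite modal algebra of finite depth accessible from an atom gives rise to a
splitting of the lattice of normal logics. -/
theorem exists_isSplittingPair (A : Type*) [ModalAlgebra A] [Finite A] {d : ℕ}
    (hd : necBot A d = ⊤) {r : A} (hr : IsAtom r) :
    ∃ χ : Formula, ¬ Validates A χ ∧ IsSplittingPair (rootLogic r) (normalClosure {χ}) := by
  have := Fintype.ofFinite A
  obtain ⟨k, ⟨e₀⟩⟩ := Finite.exists_equiv_fin A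
  let e : A → ℕ := fun a => e₀ a
  have he : Function.Injective e := fun a b h => e₀.injective (Fin.ext h)
  -- A Jankov-style formula: it denies that the current point lies in the copy of `r` and that the
  -- diagram holds throughout an accessible part of bounded depth.
  let χ : Formula := ((Formula.var (e r)).and ((Formula.diagram A e).hereditarily d)).neg
  let θ₀ : ℕ → A := Function.invFun e
  have hθ₀ : ∀ a, θ₀ (e a) = a := Function.leftInverse_invFun he
  have hχ : eval θ₀ χ = rᶜ := by
    simp only [χ, eval_neg, eval_and, eval_var, hθ₀,
      eval_hereditarily_of_eq_top θ₀ (eval_diagram_eq_top hθ₀), hd, inf_top_eq]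
  refine ⟨χ, fun h => hr.1 (compl_eq_top.1 (hχ ▸ h θ₀)), fun L => ⟨?_, fun h => ?_⟩⟩
  · by_cases hL : χ ∈ L.1
    · exact Or.inr (normalClosure_le (by simpa using hL))
    left
    intro ψ hψ η n
    by_contra hn
    have hbot : r ⊓ nec^[n] (eval η ψ) = ⊥ := 
      (hr.le_iff.1 inf_le_left).resolve_right fun h => hn (inf_eq_left.1 h)
    apply hL
    let T := L.2.isTheory
    let θ : ℕ → T.Lind := fun n => IsTheory.Lind.mk T (.var n)
    let δ : T.Lind := eval θ ((Formula.diagram A e).hereditarily d)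
    have hδ : δ ≤ nec δ := eval_hereditarily_le_nec θ _ d
    have hδ' : δ ≤ eval θ (.diagram A e) := eval_hereditarily_le θ _ d
    -- The formula `□ⁿψ` is `⊤` in the Lindenbaum algebra because `ψ ∈ L`, while its value in `A` is
    -- disjoint from the atom `r`. Both facts transfer below `δ`, so the copy of `r` vanishes there.
    have h₁ := inf_eval_diagram hδ hδ' η (Formula.box^[n] ψ)
    rw [eval_nec_iterate, eval_nec_iterate, validatesLogic_lind L ψ hψ, nec_iterate_top,
      inf_top_eq] at h₁
    have h₂ := inf_eval_diagram hδ hδ' (fun i => if i = 0 then r else nec^[n] (eval η ψ))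
      ((Formula.var 0).and (.var 1))
    simp only [eval_and, eval_var, if_true, one_ne_zero, if_false, hbot] at h₂
    have h₃ := inf_eval_diagram hδ hδ' (fun _ => r) .bot
    simp only [eval_bot, inf_bot_eq] at h₃
    have h₄ : δ ⊓ θ (e r) ≤ ⊥ := by
      rw [h₃, ← h₂]
      exact le_inf inf_le_left (le_inf inf_le_right (inf_le_left.trans (h₁.le.trans inf_le_right)))
    rw [← IsTheory.Lind.mk_eq_top T, ← IsTheory.Lind.eval_mk_var]
    simp only [χ, eval_neg, eval_and, eval_var]
    change (θ (e r) ⊓ δ)ᶜ = ⊤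
    rw [inf_comm, le_bot_iff.1 h₄, compl_bot]
  · have h₁ : χ ∈ (rootLogic r).1 := h.1 (h.2 (subset_normalClosure _ rfl))
    have h₂ := h₁ θ₀ 0
    rw [Function.iterate_zero_apply, hχ, le_compl_self] at h₂
    exact hr.1 h₂

/-! ### Finite depth and logics that are not join-splittings. -/

namespace Formula

/-- A bound for the variables of a formula. -/
def varBound : Formula → ℕ
  | var n => n + 1
  | bot => 0
  | imp φ ψ => max (varBound φ) (varBound ψ)
  | box φ => varBound φ

theorem subst_congr {s t : ℕ → Formula} {φ : Formula} (h : ∀ n < φ.varBound, s n = t n) :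
    φ.subst s = φ.subst t := by
  induction φ with
  | var n => exact h n (Nat.lt_succ_self n)
  | bot => rfl
  | imp φ ψ h₁ h₂ =>
    rw [subst, subst, h₁ fun n hn => h n (lt_max_of_lt_left hn),
      h₂ fun n hn => h n (lt_max_of_lt_right hn)]
  | box φ ih => rw [subst, subst, ih h]

theorem subst_var (φ : Formula) : φ.subst var = φ := by
  induction φ with
  | var n => rfl
  | bot => rfl
  | imp φ ψ h₁ h₂ => rw [subst, h₁, h₂]
  | box φ ih => rw [subst, ih]

/-- The formula `□ⁿ⊥`. -/
def boxBot : ℕ → Formula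
  | 0 => bot
  | n + 1 => box (boxBot n)

theorem subst_boxBot (s : ℕ → Formula) (n : ℕ) : (boxBot n).subst s = boxBot n := by
  induction n with
  | zero => rfl
  | succ n ih => rw [boxBot, subst, ih]

end Formula

namespace ModalAlgebra

variable {A : Type*} [ModalAlgebra A]

theorem eval_congr {θ η : ℕ → A} {φ : Formula} (h : ∀ n < φ.varBound, θ n = η n) :
    eval θ φ = eval η φ := by
  induction φ with
  | var n => exact h n (Nat.lt_succ_self n)
  | bot => rfl
  | imp φ ψ h₁ h₂ =>
    rw [eval_imp, eval_imp, h₁ fun n hn => h n (lt_max_of_lt_left hn),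
      h₂ fun n hn => h n (lt_max_of_lt_right hn)]
  | box φ ih => rw [eval_box, eval_box, ih h]

@[simp] theorem eval_boxBot (θ : ℕ → A) (n : ℕ) : eval θ (.boxBot n) = necBot A n := by
  induction n with
  | zero => rfl
  | succ n ih => rw [Formula.boxBot, eval_box, ih, necBot_succ]

theorem exists_finite_closed {S : Set A} (hS : S.Finite) :
    ∃ C : Set A, C.Finite ∧ S ⊆ C ∧ ⊥ ∈ C ∧ ∀ a ∈ C, ∀ b ∈ C, aᶜ ⊔ b ∈ C := by
  let S' : Set A := insert ⊥ S ∪ compl '' insert ⊥ S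
  have hS' : S'.Finite := (hS.insert ⊥).union ((hS.insert ⊥).image _)
  have hsub : insert ⊥ S ⊆ latticeClosure S' :=
    Set.subset_union_left.trans subset_latticeClosure
  have hlat : IsSublattice (latticeClosure S') := isSublattice_latticeClosure
  have hcompl : latticeClosure S' ⊆ {a | aᶜ ∈ latticeClosure S'} := by
    refine latticeClosure_min ?_ ⟨fun a ha b hb => ?_, fun a ha b hb => ?_⟩
    · rintro a (ha | ⟨a, ha, rfl⟩)
      · exact subset_latticeClosure (Or.inr ⟨a, ha, rfl⟩)
      · exact subset_latticeClosure (Or.inl (by rwa [compl_compl]))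
    · change (a ⊔ b)ᶜ ∈ latticeClosure S'
      rw [compl_sup]
      exact hlat.infClosed ha hb
    · change (a ⊓ b)ᶜ ∈ latticeClosure S'
      rw [compl_inf]
      exact hlat.supClosed ha hb
  exact ⟨latticeClosure S', hS'.latticeClosure, (Set.subset_insert _ _).trans hsub,
    hsub (Set.mem_insert _ _), fun a ha b hb => hlat.supClosed (hcompl ha) hb⟩

/-- Finitely generated modal algebras of finite depth are finite. -/
theorem finite_of_generated {g : ℕ → A} (hg : (Set.range g).Finite)
    (hsurj : ∀ a, ∃ φ, eval g φ = a) {d : ℕ} (hd : necBot A d = ⊤) : Finite A := by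
  -- Below `□ʲ⁺¹⊥` the value of `□φ` depends only on `φ` below `□ʲ⊥`. So finitely many boxed values
  -- arise at each stage, and a finite Boolean closure accounts for the rest.
  have key : ∀ j : ℕ, ∃ S : Set A, S.Finite ∧
      ∀ φ, ∃ s ∈ S, necBot A j ⊓ eval g φ = necBot A j ⊓ s := by
    intro j
    induction j with
    | zero => exact ⟨{⊥}, Set.finite_singleton _, fun φ => ⟨⊥, rfl, by simp [necBot_zero]⟩⟩
    | succ j ih =>
      obtain ⟨S, hS, h⟩ := ih
      obtain ⟨C, hC, hSC, hbot, hclosed⟩ := exists_finite_closed (hg.union (hS.image nec))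
      refine ⟨C, hC, fun φ => ?_⟩
      induction φ with
      | var n => exact ⟨g n, hSC (Or.inl ⟨n, rfl⟩), rfl⟩
      | bot => exact ⟨⊥, hbot, rfl⟩
      | imp φ ψ h₁ h₂ =>
        obtain ⟨a, ha, ha'⟩ := h₁
        obtain ⟨b, hb, hb'⟩ := h₂
        exact ⟨aᶜ ⊔ b, hclosed a ha b hb, inf_imp_congr ha' hb'⟩
      | box φ _ =>
        obtain ⟨s, hs, hs'⟩ := h φ
        refine ⟨nec s, hSC (Or.inr ⟨s, hs, rfl⟩), ?_⟩
        rw [necBot_succ, eval_box, ← nec_inf, ← nec_inf, hs']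
  obtain ⟨S, hS, h⟩ := key d
  refine Set.finite_univ_iff.1 (hS.subset fun a _ => ?_)
  obtain ⟨φ, rfl⟩ := hsurj a
  obtain ⟨s, hs, hs'⟩ := h φ
  rw [hd, top_inf_eq, top_inf_eq] at hs'
  rwa [hs']

end ModalAlgebra

theorem IsTheory.boxBot_imp_succ_mem {T : Set Formula} (hT : IsTheory T) (d : ℕ) :
    (Formula.boxBot d).imp (.boxBot (d + 1)) ∈ T := by
  induction d with
  | zero => exact hT.tautology _ fun v => False.elim
  | succ d ih => exact hT.box_mono_mem ih

/-- The logic obtained from `L` by adding the axiom `□ᵈ⊥`. -/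
def boundDepth (L : NormalLogic) (d : ℕ) : NormalLogic :=
  ⟨{φ | (Formula.boxBot d).imp φ ∈ L.1},
    { tautology := fun φ h => L.2.tautology _ fun v _ => h v
      modusPonens := fun φ ψ h₁ h₂ => L.2.isTheory.mem_of_imp_imp
        (fun v => by simp only [Formula.Truth]; tauto) h₁ h₂
      substitution := fun s φ h => by
        have := L.2.substitution s _ h
        rwa [Formula.subst, Formula.subst_boxBot] at this
      necessitation := fun φ h =>
        L.2.isTheory.trans_mem (L.2.isTheory.boxBot_imp_succ_mem d) (L.2.isTheory.box_mono_mem h)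
      axiomK_mem := L.2.isTheory.mem_of_imp
        (fun v => by simp only [Formula.Truth]; tauto) L.2.axiomK_mem }⟩

theorem le_boundDepth (L : NormalLogic) (d : ℕ) : L ≤ boundDepth L d := fun φ hφ =>
  L.2.isTheory.mem_of_imp (φ := φ) (fun v => by simp only [Formula.Truth]; tauto) hφ

theorem boxBot_mem_boundDepth (L : NormalLogic) (d : ℕ) : .boxBot d ∈ (boundDepth L d).1 :=
  L.2.tautology _ fun _ => id

/-- If all splittings below `L` are below `L₀`, then `L` is included in `L₀ ⊕ □ᵈ⊥`. -/
theorem le_boundDepth_of_splittings {L L₀ : NormalLogic}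
    (h : ∀ M, IsSplitting M → M ≤ L → M ≤ L₀) (d : ℕ) : L ≤ boundDepth L₀ d := by
  intro φ hφ
  by_contra hφ'
  -- Variables not bounded by `φ.varBound` become `⊥`, which makes the Lindenbaum algebra finitely
  -- generated. The resulting theory need not be closed under substitution, so `IsTheory` takes the
  -- place of `IsNormalLogic`.
  let τ : ℕ → Formula := fun n => if n < φ.varBound then .var n else .bot
  let L' := boundDepth L₀ d
  have hL' := L'.2.isTheory
  have hT : IsTheory {ψ | ψ.subst τ ∈ L'.1} :=
    { tautology := fun ψ hψ => L'.2.substitution τ _ (L'.2.tautology _ hψ)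
      modusPonens := fun ψ χ h₁ h₂ => L'.2.modusPonens _ _ h₁ h₂
      necessitation := fun ψ h => L'.2.necessitation _ h
      box_imp_mem := fun ψ χ => hL'.box_imp_mem _ _ }
  let g : ℕ → hT.Lind := fun n => IsTheory.Lind.mk hT (.var n)
  have hg : (Set.range g).Finite := by
    refine (((Set.finite_lt_nat φ.varBound).image g).insert ⊥).subset ?_
    rintro _ ⟨n, rfl⟩
    by_cases hn : n < φ.varBound
    · exact Or.inr ⟨n, hn, rfl⟩
    · left
      refine (IsTheory.Lind.mk_eq_mk hT).2 ⟨?_, ?_⟩ <;>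
      · refine hL'.tautology _ ?_
        simp only [Formula.subst, τ, hn, if_false]
        exact fun v => id
  have hd : necBot hT.Lind d = ⊤ := by
    rw [← eval_boxBot g, IsTheory.Lind.eval_mk_var, IsTheory.Lind.mk_eq_top]
    change (Formula.boxBot d).subst τ ∈ L'.1
    rw [Formula.subst_boxBot]
    exact boxBot_mem_boundDepth L₀ d
  have : Finite hT.Lind := finite_of_generated hg (fun a => by
    obtain ⟨ψ, rfl⟩ := IsTheory.Lind.mk_surjective hT a
    exact ⟨ψ, IsTheory.Lind.eval_mk_var hT ψ⟩) hd
  have hne : IsTheory.Lind.mk hT φ ≠ ⊤ := by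
    rw [Ne, IsTheory.Lind.mk_eq_top]
    change φ.subst τ ∉ L'.1
    rwa [Formula.subst_congr (t := .var) fun n hn => if_pos hn, Formula.subst_var]
  have hne' : (IsTheory.Lind.mk hT φ)ᶜ ≠ ⊥ := mt compl_eq_bot.1 hne
  -- The logic at an atom below `¬φ` omits `φ`, so `L` contains the splitting axiom `χ`. By
  -- hypothesis so does `L₀`, whose theorems are valid in this algebra; but `χ` is not.
  obtain ⟨r, hr, hrle⟩ := (eq_bot_or_exists_atom_le _).resolve_left hne'
  obtain ⟨χ, hχ, hsplit⟩ := exists_isSplittingPair hT.Lind hd hr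
  rcases (hsplit L).1 with hL | hL
  · have h₁ := hL hφ g 0
    rw [Function.iterate_zero_apply, IsTheory.Lind.eval_mk_var] at h₁
    exact hr.1 (by simpa using le_inf h₁ hrle)
  · have h₁ : χ ∈ L₀.1 := h _ ⟨_, hsplit⟩ hL (subset_normalClosure _ rfl)
    exact hχ (IsTheory.Lind.validates_of_subst_mem hT fun s =>
      L'.2.substitution τ _ (L'.2.substitution s _ (le_boundDepth L₀ d h₁)))

/-- Otherwise the join of all splittings below `L` would contain `L`, hence equal it. -/
theorem exists_not_le_of_not_isJoinSplitting {L : NormalLogic} (hL : ¬ IsJoinSplitting L) :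
    ∃ L₀ : NormalLogic, (∀ M, IsSplitting M → M ≤ L → M ≤ L₀) ∧ ∃ φ ∈ L.1, φ ∉ L₀.1 := by
  by_contra! h
  let L₀ := normalClosure (⋃ M ∈ {M : NormalLogic | IsSplitting M ∧ M ≤ L}, M.1)
  have hle : L ≤ L₀ := h L₀ fun M hM hML =>
    (Set.subset_biUnion_of_mem (u := fun M : NormalLogic => M.1)
      (show M ∈ {M : NormalLogic | IsSplitting M ∧ M ≤ L} from ⟨hM, hML⟩)).trans
      (subset_normalClosure _)
  exact hL ⟨{M | IsSplitting M ∧ M ≤ L}, fun M hM => hM.1, fun M hM => hM.2,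
    fun N hN => hle.trans (normalClosure_le (Set.iUnion₂_subset fun M hM => hN hM))⟩

/-! ### One-point frames (Makinson's theorem). -/

/-- The complex algebra of the frame with a single point, which is reflexive iff `ρ`. -/
def OnePoint (_ρ : Prop) : Type := Prop

namespace OnePoint

variable (ρ : Prop)

instance : BooleanAlgebra (OnePoint ρ) := inferInstanceAs (BooleanAlgebra Prop)

instance : ModalAlgebra (OnePoint ρ) where
  dia p := (ρ ∧ p : Prop)
  dia_bot := propext (iff_of_eq (and_false _))
  dia_sup _ _ := propext and_or_left

end OnePoint

namespace OnePoint

variable {ρ : Prop}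

open Classical in
/-- The embedding of truth values into an algebra. -/
noncomputable def toAlgebra (M : Type*) [ModalAlgebra M] (p : OnePoint ρ) : M :=
  if p = (⊤ : OnePoint ρ) then ⊤ else ⊥

theorem eq_top_or_eq_bot (p : OnePoint ρ) : p = ⊤ ∨ p = ⊥ := by
  by_cases hp : (show Prop from p)
  · exact Or.inl (eq_true hp)
  · exact Or.inr (eq_false hp)

theorem top_ne_bot : (⊤ : OnePoint ρ) ≠ ⊥ := true_ne_false

variable {M : Type*} [ModalAlgebra M]

@[simp] theorem toAlgebra_top : toAlgebra M (⊤ : OnePoint ρ) = ⊤ := if_pos rfl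

@[simp] theorem toAlgebra_bot : toAlgebra M (⊥ : OnePoint ρ) = ⊥ := if_neg top_ne_bot.symm

theorem toAlgebra_imp (p q : OnePoint ρ) :
    toAlgebra M (pᶜ ⊔ q) = (toAlgebra M p)ᶜ ⊔ toAlgebra M q := by
  rcases eq_top_or_eq_bot p with rfl | rfl <;> rcases eq_top_or_eq_bot q with rfl | rfl <;> simp

theorem dia_top_of_reflexive : dia (⊤ : OnePoint True) = ⊤ := eq_true ⟨trivial, trivial⟩

theorem dia_of_irreflexive (p : OnePoint False) : dia p = ⊥ := eq_false fun h => h.1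

/-- Below `□⊥` every algebra behaves like the irreflexive point, since all boxed formulas are true
there. -/
theorem inf_eval_toAlgebra_of_irreflexive (θ : ℕ → OnePoint False) (ψ : Formula) :
    nec ⊥ ⊓ eval (fun n => toAlgebra M (θ n)) ψ = nec ⊥ ⊓ toAlgebra M (eval θ ψ) := by
  refine inf_eval_comp _ (nec_mono bot_le) (by simp) (fun p q => by rw [toAlgebra_imp])
    (fun p => ?_) θ ψ
  have hp : nec p = ⊤ := by rw [nec, dia_of_irreflexive, compl_bot]
  rw [← nec_inf, bot_inf_eq, hp, toAlgebra_top, inf_top_eq]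

/-- If `◇⊤ = ⊤`, then `⊥` and `⊤` form a subalgebra, which is that of the reflexive point. -/
theorem eval_toAlgebra_of_reflexive (hM : dia (⊤ : M) = ⊤) (θ : ℕ → OnePoint True) (ψ : Formula) :
    eval (fun n => toAlgebra M (θ n)) ψ = toAlgebra M (eval θ ψ) := by
  have h := inf_eval_comp (δ := (⊤ : M)) (toAlgebra (ρ := True) M) nec_top.ge (by simp)
    (fun p q => by rw [toAlgebra_imp]) (fun p => ?_) θ ψ
  · simpa using h
  · rcases eq_top_or_eq_bot p with rfl | rfl
    · rw [nec_top, toAlgebra_top, nec_top]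
    · simp [nec, hM, dia_top_of_reflexive]

end OnePoint

theorem bot_mem_boundDepth {L : NormalLogic} (h : (Formula.boxBot 1).imp .bot ∈ L.1) (d : ℕ) :
    Formula.bot ∈ (boundDepth L d).1 := by
  change (Formula.boxBot d).imp .bot ∈ L.1
  induction d with
  | zero => exact L.2.tautology _ fun _ => id
  | succ d ih => exact L.2.isTheory.trans_mem (L.2.isTheory.box_mono_mem ih) h

/-- A consistent logic is valid on one of the two frames with a single point. If it is not valid
on the irreflexive one, then it proves `◇⊤`. -/
theorem validates_onePoint {L L₀ : NormalLogic} (hL : IsConsistent L)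
    (h : ∀ M, IsSplitting M → M ≤ L → M ≤ L₀) :
    ValidatesLogic (OnePoint False) L ∨
      ValidatesLogic (OnePoint True) L ∧ ∀ d, Formula.bot ∈ (boundDepth L₀ d).1 := by
  by_cases h₀ : ValidatesLogic (OnePoint False) L
  · exact Or.inl h₀
  right
  simp only [ValidatesLogic, Validates, not_forall] at h₀
  obtain ⟨ψ, hψ, θ, hθ⟩ := h₀
  have hT := L.2.isTheory
  have h₁ := OnePoint.inf_eval_toAlgebra_of_irreflexive (M := hT.Lind) θ ψ
  rw [validatesLogic_lind L ψ hψ, (OnePoint.eq_top_or_eq_bot _).resolve_left hθ,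
    OnePoint.toAlgebra_bot, inf_top_eq, inf_bot_eq] at h₁
  have h₂ : (Formula.boxBot 1).imp .bot ∈ L.1 := by
    rw [← IsTheory.Lind.mk_eq_top hT, ← IsTheory.Lind.eval_mk_var]
    simp [necBot_succ, necBot_zero, h₁]
  -- The inclusion of `L` in `L₀ ⊕ □⊥` gives `□⊥ → (□⊥ → ⊥) ∈ L₀`, which contracts.
  have h₃ : (Formula.boxBot 1).imp .bot ∈ L₀.1 :=
    L₀.2.isTheory.mem_of_imp (fun v => by simp only [Formula.Truth]; tauto)
      (show (Formula.boxBot 1).imp ((Formula.boxBot 1).imp .bot) ∈ L₀.1 from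
        le_boundDepth_of_splittings h 1 h₂)
  refine ⟨fun φ hφ η => ?_, bot_mem_boundDepth h₃⟩
  refine (OnePoint.eq_top_or_eq_bot _).resolve_right fun hη => hL ?_
  have hdia : dia (⊤ : hT.Lind) = ⊤ := by
    rw [← compl_bot, ← compl_nec, h₁]
  have h₄ := OnePoint.eval_toAlgebra_of_reflexive hdia η φ
  rw [validatesLogic_lind L φ hφ, hη, OnePoint.toAlgebra_bot] at h₄
  rw [← IsTheory.Lind.mk_eq_top hT, IsTheory.Lind.mk_bot, h₄]

/-! ### What complete additivity forbids. -/

section CompletelyAdditive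

variable {M : Type*} [ModalAlgebra M]

theorem isLUB_reach (hM : IsCompletelyAdditive M) (n : ℕ) {X : Set M} {a : M} (h : IsLUB X a) :
    IsLUB (reach n '' X) (reach n a) := by
  induction n with
  | zero => simpa [reach] using h
  | succ n ih =>
    constructor
    · rintro _ ⟨x, hx, rfl⟩
      exact reach_mono _ (h.1 hx)
    · intro b hb
      refine sup_le (h.2 fun x hx => le_sup_left.trans (hb ⟨x, hx, rfl⟩)) ?_
      refine (hM _ _ ih).2 ?_
      rintro _ ⟨_, ⟨x, hx, rfl⟩, rfl⟩
      exact le_sup_right.trans (hb ⟨x, hx, rfl⟩)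

/-- If `f` preserves existing joins and `f y` meets `x`, then there is a nonzero `z ≤ y` such that
`f` maps all nonzero elements below `z` to elements that meet `x`. -/
theorem exists_le_forall_inf_ne_bot {f : M → M}
    (hf : ∀ (X : Set M) (a : M), IsLUB X a → IsLUB (f '' X) (f a)) {x y : M} (h : x ⊓ f y ≠ ⊥) :
    ∃ z ≤ y, z ≠ ⊥ ∧ ∀ u ≤ z, u ≠ ⊥ → x ⊓ f u ≠ ⊥ := by
  by_contra! hz
  apply h
  -- If no `z` works, the elements below `y` whose image misses `x` have join `y`, and then `f y`
  -- misses `x` as well.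
  have hlub : IsLUB {u : M | u ≤ y ∧ x ⊓ f u = ⊥} y := by
    refine ⟨fun u hu => hu.1, fun b hb => ?_⟩
    by_contra hyb
    obtain ⟨u, huz, hu, hxu⟩ := hz (y ⊓ bᶜ) inf_le_left
      (fun h' => hyb (le_compl_iff_disjoint_right.2 (disjoint_iff.2 h') |>.trans (compl_compl b).le))
    have hub : u ≤ b := hb ⟨huz.trans inf_le_left, hxu⟩
    exact hu (by simpa using le_inf hub (huz.trans inf_le_right))
  have : f y ≤ xᶜ := (hf _ _ hlub).2 (by
    rintro _ ⟨u, hu, rfl⟩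
    rw [le_compl_iff_disjoint_left, disjoint_iff]
    exact hu.2)
  rwa [le_compl_iff_disjoint_left, disjoint_iff] at this

/-- If `a ≠ ⊥`, complete additivity localises twice: to a nonzero `y ≤ b` all of whose nonzero parts
are reachable from a part of `a`, and to a nonzero `v ≤ w` all of whose nonzero parts are seen from
a part of `y`. The axiom then yields `u ≤ ◇(u ∧ ¬◇u)` for all `u ≤ v`. Applied to `z = v ∧ ¬◇v` this
gives `z ≤ ◇v`, so `z = ⊥`; applied to `v` it gives `v ≤ ◇z = ⊥`. -/
theorem eq_bot_of_van_benthem (hM : IsCompletelyAdditive M) {n : ℕ} {a b w : M}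
    (hb : b ≤ dia w) (ha : a ≤ reach n b)
    (hu : ∀ u, a ≤ (reach n (b ⊓ dia (w ⊓ u ⊓ (dia (w ⊓ u ⊓ (dia (w ⊓ u))ᶜ))ᶜ)))ᶜ) : a = ⊥ := by
  by_contra hne
  obtain ⟨y, hyb, hy, hy'⟩ := exists_le_forall_inf_ne_bot (f := reach n) (x := a) (y := b)
    (fun X c h => isLUB_reach hM n h) (by rwa [inf_eq_left.2 ha])
  have hy₁ : ∀ u ≤ w, y ⊓ dia (u ⊓ (dia (u ⊓ (dia u)ᶜ))ᶜ) = ⊥ := by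
    intro u huw
    by_contra h
    have h₁ := hu u
    rw [inf_eq_right.2 huw, le_compl_iff_disjoint_right, disjoint_iff] at h₁
    refine hy' _ inf_le_left h (le_bot_iff.1 (le_trans ?_ h₁.le))
    exact inf_le_inf_left _ (reach_mono n (inf_le_inf_right _ hyb))
  obtain ⟨v, hvw, hv, hv'⟩ := exists_le_forall_inf_ne_bot (x := y) (y := w) hM
    (by rwa [inf_eq_left.2 (hyb.trans hb)])
  have hv₁ : ∀ u ≤ v, u ≤ dia (u ⊓ (dia u)ᶜ) := by
    intro u huv
    by_contra h
    refine hv' _ (inf_le_left.trans huv) (fun h' => h ?_) (hy₁ u (huv.trans hvw))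
    rw [← disjoint_iff, ← le_compl_iff_disjoint_right, compl_compl] at h'
    exact h'
  let z := v ⊓ (dia v)ᶜ
  have hz : z = ⊥ := by
    have h₁ : z ≤ dia v := (hv₁ z inf_le_left).trans (dia_mono (inf_le_left.trans inf_le_left))
    have h₂ : z ≤ (dia v)ᶜ := inf_le_right
    simpa using le_inf h₁ h₂
  have h₃ := hv₁ v le_rfl
  change v ≤ dia z at h₃
  rw [hz, dia_bot] at h₃
  exact hv (le_bot_iff.1 h₃)

end CompletelyAdditive

/-! ### Terms that define the hub and the chain from the tip. -/

namespace ModalAlgebra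

section Terms

variable {M : Type*} [ModalAlgebra M]

/-- Starting from a point of `ladder c k`, any sequence of at most `k - 1` steps outside `c` stays
in `dia c`, and such sequences exist. -/
def ladder (c : M) : ℕ → M
  | 0 => ⊤
  | k + 1 => dia c ⊓ dia (cᶜ ⊓ ladder c k) ⊓ (dia (cᶜ ⊓ (ladder c k)ᶜ))ᶜ

/-- The points that see a point of `ladder c k`. -/
def region (c : M) (k : ℕ) : M := dia (ladder c k)

/-- The points outside `region c k` that see a point of `region c k`. -/
def entrance (c : M) (k : ℕ) : M := dia (region c k) ⊓ (region c k)ᶜ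

/-- The points of `region c k` that start a path of length `n` within it. -/
def height (c : M) (k : ℕ) : ℕ → M
  | 0 => region c k
  | n + 1 => region c k ⊓ dia (height c k n)

/-- The points of `region c k` of height exactly `n + 1` that see `c`. -/
def marked (c : M) (k n : ℕ) : M :=
  height c k (n + 1) ⊓ (height c k (n + 2))ᶜ ⊓ dia c

/-- The points of `entrance c k` at which van Benthem's axiom for `u` fails. -/
def defect (c : M) (k : ℕ) (u : M) : M :=
  entrance c k ⊓ dia (region c k ⊓ u ⊓ (dia (region c k ⊓ u ⊓ (dia (region c k ⊓ u))ᶜ))ᶜ)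

/-- Makes long ladders empty in algebras of bounded depth. -/
theorem ladder_le_diaTop (c : M) (k : ℕ) : ladder c k ≤ diaTop M k := by
  induction k with
  | zero => exact le_rfl
  | succ k ih =>
    rw [diaTop_succ]
    exact inf_le_left.trans (inf_le_right.trans (dia_mono (inf_le_right.trans ih)))

end Terms

end ModalAlgebra

namespace Formula

/-- The formula for `ModalAlgebra.reach`. -/
def reach : ℕ → Formula → Formula
  | 0, φ => φ
  | n + 1, φ => φ.or (reach n φ).dia

/-- The formula for `ModalAlgebra.ladder`. -/
def ladder (c : Formula) : ℕ → Formula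
  | 0 => top
  | k + 1 => (c.dia.and (c.neg.and (ladder c k)).dia).and (c.neg.and (ladder c k).neg).dia.neg

/-- The formula for `ModalAlgebra.region`. -/
def region (c : Formula) (k : ℕ) : Formula := (ladder c k).dia

/-- The formula for `ModalAlgebra.entrance`. -/
def entrance (c : Formula) (k : ℕ) : Formula := (region c k).dia.and (region c k).neg

/-- The formula for `ModalAlgebra.height`. -/
def height (c : Formula) (k : ℕ) : ℕ → Formula
  | 0 => region c k
  | n + 1 => (region c k).and (height c k n).dia

/-- The formula for `ModalAlgebra.marked`. -/
def marked (c : Formula) (k n : ℕ) : Formula :=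
  ((height c k (n + 1)).and (height c k (n + 2)).neg).and c.dia

/-- The formula for `ModalAlgebra.defect`. -/
def defect (c : Formula) (k : ℕ) (u : Formula) : Formula :=
  (entrance c k).and (((region c k).and u).and
    (((region c k).and u).and ((region c k).and u).dia.neg).dia.neg).dia

end Formula

namespace ModalAlgebra

section EvalTerms

variable {M : Type*} [ModalAlgebra M] (θ : ℕ → M) (c u : Formula) (k n : ℕ)

@[simp] theorem eval_reach : eval θ (.reach n c) = reach n (eval θ c) := by
  induction n with
  | zero => rfl
  | succ n ih => simp [Formula.reach, reach, ih]

@[simp] theorem eval_ladder : eval θ (.ladder c k) = ladder (eval θ c) k := by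
  induction k with
  | zero => simp [Formula.ladder, ladder]
  | succ k ih => simp [Formula.ladder, ladder, ih]

@[simp] theorem eval_region : eval θ (.region c k) = region (eval θ c) k := by
  simp [Formula.region, region]

@[simp] theorem eval_entrance : eval θ (.entrance c k) = entrance (eval θ c) k := by
  simp [Formula.entrance, entrance]

@[simp] theorem eval_height : eval θ (.height c k n) = height (eval θ c) k n := by
  induction n with
  | zero => simp [Formula.height, height]
  | succ n ih => simp [Formula.height, height, ih]

@[simp] theorem eval_marked : eval θ (.marked c k n) = marked (eval θ c) k n := by
  simp [Formula.marked, marked]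

@[simp] theorem eval_defect : eval θ (.defect c k u) = defect (eval θ c) k (eval θ u) := by
  simp [Formula.defect, defect]

end EvalTerms

end ModalAlgebra

/-! ### The gadget and the values of the terms in it. -/

/-- A finite-depth tree-like frame whose nodes also see elements of an algebra. -/
structure Tree (A : Type) [ModalAlgebra A] (d : ℕ) where
  Node : Type
  root : Node
  level : Node → ℕ
  rel : Node → Node → Prop
  sees : Node → A → Prop
  sees_bot : ∀ t, ¬ sees t ⊥
  sees_sup : ∀ t a b, sees t (a ⊔ b) ↔ sees t a ∨ sees t b
  level_le : ∀ t, level t ≤ d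
  level_rel : ∀ s t, rel s t → level t = level s + 1
  exists_rel : ∀ s, level s < d → ∃ t, rel s t
  eq_root : ∀ t, level t = 0 → t = root
  exists_rel_left : ∀ t, level t ≠ 0 → ∃ s, rel s t

variable {A : Type} [ModalAlgebra A] {d : ℕ}

/-- The points added to a tree: a descending sequence of links that leads to the root, the hub,
which is seen by the last level of the tree, and an infinite chain. -/
inductive Point (D : Tree A d) : Type
  | tree (t : D.Node)
  | link (j : Fin (d + 3))
  | hub
  | chain (n : ℕ)

/-- The product of the algebra of all sets of points with `A` and the algebra of a single point. -/
def Gadget (D : Tree A d) (_I : Set ℕ) (ρ : Prop) : Type := Set (Point D) × (A × OnePoint ρ)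

namespace Gadget

variable {D : Tree A d} {I : Set ℕ} {ρ : Prop}

instance : BooleanAlgebra (Gadget D I ρ) :=
  inferInstanceAs (BooleanAlgebra (Set (Point D) × (A × OnePoint ρ)))

/-- The element `x` holds at the point `s`. -/
def Sat (x : Gadget D I ρ) (s : Point D) : Prop := s ∈ x.1

/-- The component of `x` in `A`. -/
def base (x : Gadget D I ρ) : A := x.2.1

/-- The component of `x` in the algebra of the single point. -/
def tip (x : Gadget D I ρ) : OnePoint ρ := x.2.2

theorem ext_iff' {x y : Gadget D I ρ} :
    x = y ↔ (∀ s, x.Sat s ↔ y.Sat s) ∧ x.base = y.base ∧ x.tip = y.tip := by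
  constructor
  · rintro rfl
    exact ⟨fun s => Iff.rfl, rfl, rfl⟩
  · rintro ⟨h₁, h₂, h₃⟩
    exact Prod.ext (Set.ext h₁) (Prod.ext h₂ h₃)

/-- The points that see something in `x`. The hub sees the infinite subsets of the chain. -/
def Dia (x : Gadget D I ρ) : Point D → Prop
  | .tree t => (∃ s, D.rel t s ∧ x.Sat (.tree s)) ∨ D.sees t x.base ∨ (D.level t = d ∧ x.Sat .hub)
  | .link j => (0 < j.val ∧ x.tip = ⊤) ∨ (j.val = 0 ∧ x.Sat (.tree D.root)) ∨
      ∃ i : Fin (d + 3), j.val = i.val + 1 ∧ x.Sat (.link i)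
  | .hub => {n | x.Sat (.chain n)}.Infinite
  | .chain n => (∃ m < n, x.Sat (.chain m)) ∨ x.Sat (.link (Fin.last _)) ∨
      ((∃ i ∈ I, n = i + 1) ∧ x.tip = ⊤)

section BooleanOperations

variable (x y : Gadget D I ρ) (s : Point D)

@[simp] theorem sat_top : (⊤ : Gadget D I ρ).Sat s := trivial
@[simp] theorem not_sat_bot : ¬ (⊥ : Gadget D I ρ).Sat s := id
@[simp] theorem sat_sup : (x ⊔ y).Sat s ↔ x.Sat s ∨ y.Sat s := Iff.rfl
@[simp] theorem sat_inf : (x ⊓ y).Sat s ↔ x.Sat s ∧ y.Sat s := Iff.rfl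
@[simp] theorem sat_compl : xᶜ.Sat s ↔ ¬ x.Sat s := Iff.rfl
@[simp] theorem base_top : (⊤ : Gadget D I ρ).base = ⊤ := rfl
@[simp] theorem base_bot : (⊥ : Gadget D I ρ).base = ⊥ := rfl
@[simp] theorem base_sup : (x ⊔ y).base = x.base ⊔ y.base := rfl
@[simp] theorem base_inf : (x ⊓ y).base = x.base ⊓ y.base := rfl
@[simp] theorem base_compl : xᶜ.base = x.baseᶜ := rfl
@[simp] theorem tip_top : (⊤ : Gadget D I ρ).tip = ⊤ := rfl
@[simp] theorem tip_bot : (⊥ : Gadget D I ρ).tip = ⊥ := rfl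
@[simp] theorem tip_sup : (x ⊔ y).tip = x.tip ⊔ y.tip := rfl
@[simp] theorem tip_inf : (x ⊓ y).tip = x.tip ⊓ y.tip := rfl
@[simp] theorem tip_compl : xᶜ.tip = x.tipᶜ := rfl

end BooleanOperations

theorem _root_.ModalLogic.OnePoint.sup_eq_top_iff (p q : OnePoint ρ) :
    p ⊔ q = ⊤ ↔ p = ⊤ ∨ q = ⊤ := by
  rcases p.eq_top_or_eq_bot with rfl | rfl <;> simp [OnePoint.top_ne_bot.symm]

theorem or_or_or_distrib {a b c a' b' c' : Prop} :
    (a ∨ a') ∨ (b ∨ b') ∨ (c ∨ c') ↔ (a ∨ b ∨ c) ∨ (a' ∨ b' ∨ c') := by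
  tauto

theorem dia_sup_iff (x y : Gadget D I ρ) (s : Point D) :
    (x ⊔ y).Dia s ↔ x.Dia s ∨ y.Dia s := by
  cases s with
  | tree t =>
    simp only [Dia, sat_sup, base_sup, D.sees_sup, and_or_left, exists_or]
    exact or_or_or_distrib
  | link j =>
    simp only [Dia, sat_sup, tip_sup, OnePoint.sup_eq_top_iff, and_or_left, exists_or]
    exact or_or_or_distrib
  | hub => exact Set.infinite_union
  | chain n =>
    simp only [Dia, sat_sup, tip_sup, OnePoint.sup_eq_top_iff, and_or_left, exists_or]
    exact or_or_or_distrib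

instance : ModalAlgebra (Gadget D I ρ) where
  dia x := (({s | x.Dia s}, (dia x.base, dia x.tip)) : Set (Point D) × (A × OnePoint ρ))
  dia_bot := by
    refine ext_iff'.2 ⟨fun s => iff_of_false ?_ id, dia_bot, dia_bot⟩
    change ¬ (⊥ : Gadget D I ρ).Dia s
    cases s <;> simp [Dia, D.sees_bot, OnePoint.top_ne_bot.symm]
  dia_sup x y := ext_iff'.2 ⟨dia_sup_iff x y, ModalAlgebra.dia_sup _ _, ModalAlgebra.dia_sup _ _⟩

section Dia

variable (x : Gadget D I ρ)

@[simp] theorem base_dia : (dia x).base = dia x.base := rfl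
@[simp] theorem tip_dia : (dia x).tip = dia x.tip := rfl

theorem sat_dia_tree (t : D.Node) : (dia x).Sat (.tree t) ↔
    (∃ s, D.rel t s ∧ x.Sat (.tree s)) ∨ D.sees t x.base ∨ (D.level t = d ∧ x.Sat .hub) := Iff.rfl

theorem sat_dia_link (j : Fin (d + 3)) : (dia x).Sat (.link j) ↔
    (0 < j.val ∧ x.tip = ⊤) ∨ (j.val = 0 ∧ x.Sat (.tree D.root)) ∨
      ∃ i : Fin (d + 3), j.val = i.val + 1 ∧ x.Sat (.link i) := Iff.rfl

theorem sat_dia_hub : (dia x).Sat .hub ↔ {n | x.Sat (.chain n)}.Infinite := Iff.rfl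

theorem sat_dia_chain (n : ℕ) : (dia x).Sat (.chain n) ↔
    (∃ m < n, x.Sat (.chain m)) ∨ x.Sat (.link (Fin.last _)) ∨
      ((∃ i ∈ I, n = i + 1) ∧ x.tip = ⊤) := Iff.rfl

end Dia

theorem base_eval (θ : ℕ → Gadget D I ρ) (φ : Formula) :
    (eval θ φ).base = eval (fun n => (θ n).base) φ := by
  induction φ with
  | var n => rfl
  | bot => rfl
  | imp φ ψ h₁ h₂ => simp [h₁, h₂]
  | box φ h => simp [nec, h]

theorem tip_eval (θ : ℕ → Gadget D I ρ) (φ : Formula) :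
    (eval θ φ).tip = eval (fun n => (θ n).tip) φ := by
  induction φ with
  | var n => rfl
  | bot => rfl
  | imp φ ψ h₁ h₂ => simp [h₁, h₂]
  | box φ h => simp [nec, h]

theorem base_ladder (c : Gadget D I ρ) (k : ℕ) : (ladder c k).base = ladder c.base k := by
  induction k with
  | zero => rfl
  | succ k ih => simp [ladder, ih]

/-- Elements that are false at all points and true in the single point frame. -/
structure IsTip (c : Gadget D I ρ) : Prop where
  not_sat : ∀ s, ¬ c.Sat s
  tip_eq : c.tip = ⊤

namespace IsTip

variable {c : Gadget D I ρ}

theorem sat_dia_link (hc : IsTip c) (j : Fin (d + 3)) : (dia c).Sat (.link j) ↔ 0 < j.val := by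
  simp [Gadget.sat_dia_link, hc.not_sat, hc.tip_eq]

theorem not_sat_dia_hub (hc : IsTip c) : ¬ (dia c).Sat .hub := by
  simp [Gadget.sat_dia_hub, hc.not_sat]

theorem sat_dia_chain (hc : IsTip c) (n : ℕ) :
    (dia c).Sat (.chain n) ↔ ∃ i ∈ I, n = i + 1 := by
  simp [Gadget.sat_dia_chain, hc.not_sat, hc.tip_eq]

theorem tip_inf_compl (hc : IsTip c) (x : Gadget D I ρ) : (cᶜ ⊓ x).tip = ⊥ := by
  simp [hc.tip_eq]

theorem sat_ladder_link (hc : IsTip c) (k : ℕ) (j : Fin (d + 3)) :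
    (ladder c k).Sat (.link j) ↔ k ≤ j.val := by
  induction k generalizing j with
  | zero => simp [ladder]
  | succ k ih =>
    rw [ladder, sat_inf, sat_inf, sat_compl, hc.sat_dia_link]
    constructor
    · rintro ⟨⟨h₁, h₂⟩, h₃⟩
      rw [Gadget.sat_dia_link, hc.tip_inf_compl] at h₂
      rcases h₂ with h₂ | h₂ | ⟨i, hi, h₂⟩
      · exact absurd h₂.2 OnePoint.top_ne_bot.symm
      · omega
      · rw [sat_inf, ih] at h₂
        omega
    · intro h
      have hi : j.val - 1 < d + 3 := by omega
      refine ⟨⟨by omega, ?_⟩, ?_⟩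
      · rw [Gadget.sat_dia_link]
        refine Or.inr (Or.inr ⟨⟨j.val - 1, hi⟩, by simp only; omega,
          (sat_inf _ _ _).2 ⟨hc.not_sat _, (ih _).2 ?_⟩⟩)
        simp only
        omega
      · rw [Gadget.sat_dia_link, hc.tip_inf_compl]
        rintro (h₂ | h₂ | ⟨i, hi, h₂⟩)
        · exact absurd h₂.2 OnePoint.top_ne_bot.symm
        · omega
        · rw [sat_inf, sat_compl, sat_compl, ih] at h₂
          omega

theorem not_sat_ladder_hub (hc : IsTip c) {k : ℕ} (hk : k ≠ 0) : ¬ (ladder c k).Sat .hub := by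
  obtain ⟨k, rfl⟩ := Nat.exists_eq_succ_of_ne_zero hk
  exact fun h => hc.not_sat_dia_hub h.1.1

/-- Tree points may see `c` through `A`, so `dia c` does not exclude them. The last conjunct of the
ladder does: each tree point has a successor outside `c`, one level deeper or the hub, that fails
the shorter ladder. -/
theorem not_sat_ladder_tree (hc : IsTip c) (k : ℕ) (t : D.Node) (h : d + 2 ≤ D.level t + k) :
    ¬ (ladder c k).Sat (.tree t) := by
  induction k generalizing t with
  | zero => have := D.level_le t; omega
  | succ k ih =>
    intro hs
    refine hs.2 ?_
    change (dia (cᶜ ⊓ (ladder c k)ᶜ)).Sat _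
    rw [sat_dia_tree]
    rcases (D.level_le t).lt_or_eq with ht | ht
    · obtain ⟨s, hs⟩ := D.exists_rel t ht
      have := D.level_rel _ _ hs
      exact Or.inl ⟨s, hs, hc.not_sat _, ih s (by omega)⟩
    · exact Or.inr (Or.inr ⟨ht, hc.not_sat _, hc.not_sat_ladder_hub (by omega)⟩)

/-- The shift `n = i + 1` in `Dia` keeps `chain 0` from seeing the tip. So `chain 0` is off the
ladder, and all later chain points see it. -/
theorem not_sat_ladder_chain (hc : IsTip c) (k n : ℕ) : ¬ (ladder c (k + 2)).Sat (.chain n) := by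
  have h₀ : ¬ (ladder c (k + 1)).Sat (.chain 0) := by
    intro h
    have h' : (dia c).Sat (.chain 0) := h.1.1
    simp [hc.sat_dia_chain] at h'
  intro h
  rcases Nat.eq_zero_or_pos n with rfl | hn
  · have h' : (dia c).Sat (.chain 0) := h.1.1
    simp [hc.sat_dia_chain] at h'
  · exact h.2 (Or.inl ⟨0, hn, hc.not_sat _, h₀⟩)

/-- The length `d + 2` is the index of the last link and also exceeds the height of the tree. -/
theorem sat_ladder (hc : IsTip c) (s : Point D) :
    (ladder c (d + 2)).Sat s ↔ s = .link (Fin.last _) := by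
  cases s with
  | tree t => simp [hc.not_sat_ladder_tree (d + 2) t (by omega)]
  | link j =>
    rw [hc.sat_ladder_link, Point.link.injEq, Fin.ext_iff, Fin.val_last]
    omega
  | hub => simp [hc.not_sat_ladder_hub]
  | chain n => simp [hc.not_sat_ladder_chain]

theorem tip_ladder (hc : IsTip c) (k : ℕ) : (ladder c (k + 1)).tip = ⊥ := by
  simp [ladder, hc.tip_eq, ModalAlgebra.dia_bot]

theorem base_ladder_eq_bot (hA : necBot A d = ⊤) : (ladder c (d + 2)).base = ⊥ := by
  rw [base_ladder, ← le_bot_iff]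
  refine (ladder_le_diaTop _ _).trans ((diaTop_succ_le _).trans ((diaTop_succ_le _).trans ?_))
  rw [← compl_necBot, hA, compl_top]

theorem sat_region (hc : IsTip c) (hA : necBot A d = ⊤) (s : Point D) :
    (region c (d + 2)).Sat s ↔ ∃ n, s = .chain n := by
  cases s with
  | tree t =>
    simp [region, sat_dia_tree, hc.sat_ladder, base_ladder_eq_bot hA, D.sees_bot]
  | link j =>
    simp only [region, Gadget.sat_dia_link, hc.sat_ladder, hc.tip_ladder, reduceCtorEq, and_false,
      Point.link.injEq, false_or, exists_eq_right, exists_false, iff_false, Fin.val_last,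
      OnePoint.top_ne_bot.symm]
    omega
  | hub => simp [region, sat_dia_hub, hc.sat_ladder]
  | chain n => simp [region, Gadget.sat_dia_chain, hc.sat_ladder]

theorem base_region (hA : necBot A d = ⊤) : (region c (d + 2)).base = ⊥ := by
  simp [region, base_ladder_eq_bot hA, ModalAlgebra.dia_bot]

theorem tip_region (hc : IsTip c) (k : ℕ) : (region c (k + 1)).tip = ⊥ := by
  simp [region, hc.tip_ladder, ModalAlgebra.dia_bot]

theorem sat_entrance (hc : IsTip c) (hA : necBot A d = ⊤) (s : Point D) :
    (entrance c (d + 2)).Sat s ↔ s = .hub := by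
  rw [entrance, sat_inf, sat_compl, hc.sat_region hA]
  cases s with
  | tree t => simp [sat_dia_tree, hc.sat_region hA, base_region hA, D.sees_bot]
  | link j =>
    simp [Gadget.sat_dia_link, hc.sat_region hA, hc.tip_region, OnePoint.top_ne_bot.symm]
  | hub => simp [sat_dia_hub, hc.sat_region hA, Set.infinite_univ]
  | chain n => simp

theorem base_entrance (hA : necBot A d = ⊤) : (entrance c (d + 2)).base = ⊥ := by
  simp [entrance, base_region hA, ModalAlgebra.dia_bot]

theorem tip_entrance (hc : IsTip c) (k : ℕ) : (entrance c (k + 1)).tip = ⊥ := by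
  simp [entrance, hc.tip_region, ModalAlgebra.dia_bot]

/-- If `u` meets the chain, its chain points outside `dia` of that set reduce to the least one,
which all the others see. The element under the outer diamond is thus a single chain point, and the
hub sees only infinite sets. -/
theorem defect_eq_bot (hc : IsTip c) (hA : necBot A d = ⊤) (u : Gadget D I ρ) :
    defect c (d + 2) u = ⊥ := by
  refine ext_iff'.2 ⟨fun s => iff_of_false ?_ (not_sat_bot s), ?_, ?_⟩
  · rw [defect, sat_inf, hc.sat_entrance hA]
    rintro ⟨rfl, h⟩
    rw [sat_dia_hub] at h
    obtain ⟨n₀, hn₀, h₀⟩ := h.exists_gt 0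
    have hex : ∃ n, (region c (d + 2) ⊓ u).Sat (.chain n) := ⟨n₀, hn₀.1⟩
    classical
    obtain ⟨n, hn, hlt⟩ := h.exists_gt (Nat.find hex)
    refine hn.2 ((Gadget.sat_dia_chain _ _).2 (Or.inl ⟨Nat.find hex, hlt, Nat.find_spec hex, ?_⟩))
    change ¬ (dia (region c (d + 2) ⊓ u)).Sat _
    rw [Gadget.sat_dia_chain, sat_inf _ _ (.link _), tip_inf, hc.tip_region, bot_inf_eq,
      hc.sat_region hA]
    rintro (⟨m, hm, hm'⟩ | h' | h')
    · exact Nat.find_min hex hm hm'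
    · simp at h'
    · exact OnePoint.top_ne_bot h'.2.symm
  · simp [defect, base_entrance hA]
  · simp [defect, hc.tip_entrance]

theorem sat_height (hc : IsTip c) (hA : necBot A d = ⊤) (n : ℕ) (s : Point D) :
    (height c (d + 2) n).Sat s ↔ ∃ m, n ≤ m ∧ s = .chain m := by
  have htip : ∀ k, (height c (d + 2) k).tip = ⊥ := fun k => by
    cases k <;> simp [height, hc.tip_region]
  induction n generalizing s with
  | zero => simp [height, hc.sat_region hA]
  | succ n ih =>
    rw [height, sat_inf, hc.sat_region hA]
    constructor
    · rintro ⟨⟨m, rfl⟩, h⟩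
      simp only [Gadget.sat_dia_chain, htip, ih] at h
      rcases h with ⟨k, hk, k', hk', h⟩ | ⟨k, hk, h⟩ | h
      · cases h
        exact ⟨m, by omega, rfl⟩
      · cases h
      · exact absurd h.2.symm OnePoint.top_ne_bot
    · rintro ⟨m, hm, rfl⟩
      exact ⟨⟨m, rfl⟩, (Gadget.sat_dia_chain _ _).2
        (Or.inl ⟨n, by omega, (ih _).2 ⟨n, le_rfl, rfl⟩⟩)⟩

/-- The set `I` is read off here: height identifies a chain point, and seeing the tip tells whether
its index is coded. -/
theorem sat_marked (hc : IsTip c) (hA : necBot A d = ⊤) (n : ℕ) (s : Point D) :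
    (marked c (d + 2) n).Sat s ↔ n ∈ I ∧ s = .chain (n + 1) := by
  rw [marked, sat_inf, sat_inf, sat_compl, hc.sat_height hA, hc.sat_height hA]
  constructor
  · rintro ⟨⟨⟨m, hm, rfl⟩, h₂⟩, h₃⟩
    have : m < n + 2 := by
      by_contra h
      exact h₂ ⟨m, by omega, rfl⟩
    obtain rfl : m = n + 1 := by omega
    obtain ⟨i, hi, h⟩ := (hc.sat_dia_chain _).1 h₃
    obtain rfl : n = i := by omega
    exact ⟨hi, rfl⟩
  · rintro ⟨hn, rfl⟩
    refine ⟨⟨⟨n + 1, le_rfl, rfl⟩, ?_⟩, (hc.sat_dia_chain _).2 ⟨n, hn, rfl⟩⟩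
    rintro ⟨m, hm, h⟩
    cases h
    omega

theorem marked_eq_bot (hc : IsTip c) (hA : necBot A d = ⊤) {n : ℕ} (hn : n ∉ I) :
    marked c (d + 2) n = ⊥ := by
  refine ext_iff'.2 ⟨fun s => ?_, ?_, ?_⟩
  · rw [hc.sat_marked hA]
    exact iff_of_false (fun h => hn h.1) (not_sat_bot s)
  · simp [marked, height, base_region hA]
  · simp [marked, height, hc.tip_region]

end IsTip

/-! ### Reachability along the cycle. -/

section Reach

variable {x : Gadget D I ρ}

theorem Sat.of_le {x y : Gadget D I ρ} {s : Point D} (h : x.Sat s) (hxy : x ≤ y) : y.Sat s :=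
  hxy.1 h

theorem sat_reach_succ {n : ℕ} {s : Point D} (h : (dia (reach n x)).Sat s) :
    (reach (n + 1) x).Sat s := Or.inr h

theorem sat_reach_tree (h : x.Sat .hub) (k : ℕ) (t : D.Node) (ht : D.level t + k = d) :
    (reach (k + 1) x).Sat (.tree t) := by
  induction k generalizing t with
  | zero => exact sat_reach_succ ((sat_dia_tree _ _).2 (Or.inr (Or.inr ⟨ht, h⟩)))
  | succ k ih =>
    obtain ⟨s, hs⟩ := D.exists_rel t (by omega)
    have := D.level_rel _ _ hs
    exact sat_reach_succ ((sat_dia_tree _ _).2 (Or.inl ⟨s, hs, ih s (by omega)⟩))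

theorem sat_reach_link {n : ℕ} {j₀ : ℕ} (hj₀ : j₀ < d + 3) (h : (reach n x).Sat (.link ⟨j₀, hj₀⟩))
    (k : ℕ) (hk : j₀ + k < d + 3) : (reach (n + k) x).Sat (.link ⟨j₀ + k, hk⟩) := by
  induction k with
  | zero => exact h
  | succ k ih =>
    exact sat_reach_succ ((sat_dia_link _ _).2 (Or.inr (Or.inr ⟨_, rfl, ih (by omega)⟩)))

theorem sat_reach_link_zero {n : ℕ} (h : (reach n x).Sat (.tree D.root)) :
    (reach (n + 1) x).Sat (.link ⟨0, by omega⟩) :=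
  sat_reach_succ ((sat_dia_link _ _).2 (Or.inr (Or.inl ⟨rfl, h⟩)))

theorem sat_reach_root (k : ℕ) (t : D.Node) (hk : D.level t = k) {n : ℕ}
    (ht : (reach n x).Sat (.tree t)) : (reach (n + k) x).Sat (.tree D.root) := by
  induction k generalizing t n with
  | zero => rwa [D.eq_root t hk] at ht
  | succ k ih =>
    obtain ⟨s, hs⟩ := D.exists_rel_left t (by omega)
    have := D.level_rel _ _ hs
    rw [show n + (k + 1) = n + 1 + k by omega]
    exact ih s (by omega) (sat_reach_succ ((sat_dia_tree _ _).2 (Or.inl ⟨t, hs, ht⟩)))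

theorem sat_reach_chain {n : ℕ} (h : (reach n x).Sat (.link (Fin.last _))) (m : ℕ) :
    (reach (n + 1) x).Sat (.chain m) :=
  sat_reach_succ ((sat_dia_chain _ _).2 (Or.inr (Or.inl h)))

/-- The longest way to the hub starts in the chain: 1 step to the last link, `d + 2` to the first, 1
to the root, `d` to the last level and 1 to the hub. -/
theorem sat_reach_of_sat_hub (h : x.Sat .hub) (s : Point D) : (reach (2 * d + 5) x).Sat s := by
  have hroot : (reach (d + 1) x).Sat (.tree D.root) :=
    (sat_reach_tree h (d - D.level D.root) D.root (by have := D.level_le D.root; omega)).of_le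
      (reach_le_of_le (by omega) _)
  have hlink := sat_reach_link (by omega) (sat_reach_link_zero hroot)
  cases s with
  | tree t =>
    exact (sat_reach_tree h (d - D.level t) t (by have := D.level_le t; omega)).of_le
      (reach_le_of_le (by omega) _)
  | link j =>
    have := hlink j.val (by omega)
    simp only [zero_add] at this
    exact this.of_le (reach_le_of_le (by omega) _)
  | hub => exact h.of_le (le_reach _ _)
  | chain n =>
    have := hlink (d + 2) (by omega)
    simp only [zero_add] at this
    exact (sat_reach_chain this n).of_le (reach_le_of_le (by omega) _)

theorem sat_reach_hub_of_sat_link {n j₀ : ℕ} (hj₀ : j₀ < d + 3)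
    (h : (reach n x).Sat (.link ⟨j₀, hj₀⟩)) : (reach (n + (d + 2 - j₀) + 2) x).Sat .hub := by
  have h₁ := sat_reach_link hj₀ h (d + 2 - j₀) (by omega)
  have h₂ : (⟨j₀ + (d + 2 - j₀), by omega⟩ : Fin (d + 3)) = Fin.last _ := by
    rw [Fin.ext_iff, Fin.val_last]
    simp only
    omega
  rw [h₂] at h₁
  refine sat_reach_succ ((sat_dia_hub _).2 ?_)
  convert Set.infinite_univ (α := ℕ)
  exact Set.eq_univ_of_forall fun m => sat_reach_chain h₁ m

theorem sat_reach_hub {s : Point D} (h : x.Sat s) : (reach (2 * d + 5) x).Sat .hub := by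
  cases s with
  | tree t =>
    have h₁ := sat_reach_link_zero (sat_reach_root (n := 0) _ t rfl h)
    have := D.level_le t
    exact (sat_reach_hub_of_sat_link (by omega) h₁).of_le (reach_le_of_le (by omega) _)
  | link j =>
    exact (sat_reach_hub_of_sat_link (n := 0) j.2 h).of_le (reach_le_of_le (by omega) _)
  | hub => exact h.of_le (le_reach _ _)
  | chain n =>
    -- The hub does not see `chain n` itself, but it sees the infinite set of later chain points,
    -- all of which see `chain n`.
    have h₁ : ∀ m, n < m → (reach 1 x).Sat (.chain m) := fun m hm =>
      sat_reach_succ ((sat_dia_chain _ _).2 (Or.inl ⟨n, hm, h⟩))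
    refine (sat_reach_succ (n := 1) ((sat_dia_hub _).2 ?_)).of_le (reach_le_of_le (by omega) _)
    exact (Set.Ioi_infinite n).mono h₁

theorem sat_reach_hub_of_tip (h : x.tip = ⊤) : (reach (2 * d + 5) x).Sat .hub := by
  have h₁ : (reach 1 x).Sat (.link ⟨1, by omega⟩) :=
    sat_reach_succ ((sat_dia_link _ _).2 (Or.inl ⟨Nat.one_pos, h⟩))
  exact (sat_reach_hub_of_sat_link _ h₁).of_le (reach_le_of_le (by omega) _)

theorem sat_reach_of_hub (h : (reach (2 * d + 5) x).Sat .hub) (s : Point D) :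
    (reach (4 * d + 10) x).Sat s :=
  (sat_reach_of_sat_hub h s).of_le
    ((reach_reach _ _ _ _ le_rfl).trans (reach_le_of_le (by omega) _))

/-- From every point all other points can be reached within a bounded number of steps. -/
theorem sat_reach {s : Point D} (h : x.Sat s) (t : Point D) : (reach (4 * d + 10) x).Sat t :=
  sat_reach_of_hub (sat_reach_hub h) t

theorem sat_reach_of_tip (h : x.tip = ⊤) (t : Point D) : (reach (4 * d + 10) x).Sat t :=
  sat_reach_of_hub (sat_reach_hub_of_tip h) t

end Reach

end Gadget

/-! ### Unravelling the canonical frame of `L₀`. -/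

namespace Formula

/-- Modal depth. -/
def depth : Formula → ℕ
  | var _ => 0
  | bot => 0
  | imp φ ψ => max (depth φ) (depth ψ)
  | box φ => depth φ + 1

end Formula

section CanonicalTree

variable (L₀ : NormalLogic) (d : ℕ)

/-- The Lindenbaum algebra of a normal logic. -/
abbrev NormalLogic.Lind (L : NormalLogic) : Type := L.2.isTheory.Lind

/-- The class of a formula in the Lindenbaum algebra of a normal logic. -/
abbrev NormalLogic.mk (L : NormalLogic) (φ : Formula) : NormalLogic.Lind L :=
  IsTheory.Lind.mk L.2.isTheory φ

theorem mk_boxBot (n : ℕ) : NormalLogic.mk L₀ (.boxBot n) = necBot (NormalLogic.Lind L₀) n := by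
  rw [NormalLogic.mk, ← IsTheory.Lind.eval_mk_var, eval_boxBot]

theorem necBot_boundDepth : necBot (NormalLogic.Lind (boundDepth L₀ d)) d = ⊤ := by
  rw [← mk_boxBot, NormalLogic.mk, IsTheory.Lind.mk_eq_top]
  exact boxBot_mem_boundDepth L₀ d

/-- The Lindenbaum algebra of `L₀ ⊕ □ᵈ⊥` as the ideal generated by `□ᵈ⊥` in that of `L₀`. -/
def ofBoundDepth : NormalLogic.Lind (boundDepth L₀ d) → NormalLogic.Lind L₀ :=
  Quotient.lift (fun φ => NormalLogic.mk L₀ (φ.and (.boxBot d))) fun φ ψ h =>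
    (IsTheory.Lind.mk_eq_mk _).2
      ⟨L₀.2.isTheory.mem_of_imp (φ := (Formula.boxBot d).imp (φ.imp ψ))
        (fun v => by simp only [Formula.Truth, Formula.neg, Formula.and]; tauto) h.1,
       L₀.2.isTheory.mem_of_imp (φ := (Formula.boxBot d).imp (ψ.imp φ))
        (fun v => by simp only [Formula.Truth, Formula.neg, Formula.and]; tauto) h.2⟩

theorem ofBoundDepth_mk (φ : Formula) : ofBoundDepth L₀ d (NormalLogic.mk (boundDepth L₀ d) φ) =
    NormalLogic.mk L₀ φ ⊓ necBot (NormalLogic.Lind L₀) d := by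
  rw [← mk_boxBot]
  rfl

theorem ofBoundDepth_bot : ofBoundDepth L₀ d ⊥ = ⊥ := by
  rw [← IsTheory.Lind.mk_bot, ofBoundDepth_mk, NormalLogic.mk, IsTheory.Lind.mk_bot, bot_inf_eq]

theorem ofBoundDepth_sup (a b : NormalLogic.Lind (boundDepth L₀ d)) :
    ofBoundDepth L₀ d (a ⊔ b) = ofBoundDepth L₀ d a ⊔ ofBoundDepth L₀ d b := by
  obtain ⟨φ, rfl⟩ := IsTheory.Lind.mk_surjective _ a
  obtain ⟨ψ, rfl⟩ := IsTheory.Lind.mk_surjective _ b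
  rw [ofBoundDepth_mk, ofBoundDepth_mk, ← inf_sup_right]
  exact ofBoundDepth_mk L₀ d (φ.or ψ)

variable {L₀ d}

/-- There is a path of length `n` from `R` to `U` in the canonical frame. -/
def ReachesIn (R : Set (NormalLogic.Lind L₀)) : ℕ → Set (NormalLogic.Lind L₀) → Prop
  | 0, U => U = R
  | n + 1, U => ∃ V, IsPoint V ∧ ReachesIn R n V ∧ Sees V U

/-- The unravelling up to depth `d` of the canonical frame of `L₀` at `R`, restricted to the points
from which the last level can be reached. -/
def canonicalTree (R : Set (NormalLogic.Lind L₀)) (hR : IsPoint R) (hRd : diaTop _ d ∈ R) :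
    Tree (NormalLogic.Lind (boundDepth L₀ d)) d where
  Node := {p : ℕ × Set (NormalLogic.Lind L₀) //
    p.1 ≤ d ∧ IsPoint p.2 ∧ diaTop _ (d - p.1) ∈ p.2 ∧ ReachesIn R p.1 p.2}
  root := ⟨(0, R), Nat.zero_le _, hR, hRd, rfl⟩
  level t := t.1.1
  rel s t := t.1.1 = s.1.1 + 1 ∧ Sees s.1.2 t.1.2
  -- A successor is a node if it contains `◇ʲ⊤` for `j = d - t.1.1 - 1`. Otherwise it contains
  -- `□ʲ⊥`, and it is these successors that the algebra represents.
  sees t a := t.1.1 < d ∧ dia (ofBoundDepth L₀ d a ⊓ necBot _ (d - t.1.1 - 1)) ∈ t.1.2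
  sees_bot t h := t.2.2.1.bot_notMem (by
    have := h.2
    rwa [ofBoundDepth_bot, bot_inf_eq, dia_bot] at this)
  sees_sup t a b := by
    rw [ofBoundDepth_sup, inf_sup_right, dia_sup, t.2.2.1.sup_mem, and_or_left]
  level_le t := t.2.1
  level_rel _ _ h := h.1
  exists_rel s hs := by
    have h := s.2.2.2.1
    obtain ⟨k, hk⟩ : ∃ k, d - s.1.1 = k + 1 := ⟨d - s.1.1 - 1, by omega⟩
    rw [hk, diaTop_succ] at h
    obtain ⟨V, hV, hsV, hmem⟩ := exists_sees s.2.2.1 h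
    refine ⟨⟨(s.1.1 + 1, V), hs, hV, ?_, s.1.2, s.2.2.1, s.2.2.2.2, hsV⟩, rfl, hsV⟩
    rwa [show d - (s.1.1 + 1) = k by omega]
  eq_root := by
    rintro ⟨⟨n, U⟩, h₁, h₂, h₃, h₄⟩ rfl
    obtain rfl : U = R := h₄
    rfl
  exists_rel_left := by
    rintro ⟨⟨n, U⟩, h₁, h₂, h₃, h₄⟩ hn
    obtain ⟨n, rfl⟩ := Nat.exists_eq_succ_of_ne_zero hn
    obtain ⟨V, hV, hRV, hVU⟩ := h₄
    have h₁' : n + 1 ≤ d := h₁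
    refine ⟨⟨(n, V), by simp only; omega, hV, ?_, hRV⟩, rfl, hVU⟩
    have := hVU _ h₃
    rw [← diaTop_succ] at this
    rwa [show d - n = d - (n + 1) + 1 by omega]

variable {R : Set (NormalLogic.Lind L₀)} {hR : IsPoint R} {hRd : diaTop _ d ∈ R} {I : Set ℕ}
  {ρ : Prop}

/-- The canonical valuation. -/
def canonicalVal (R : Set (NormalLogic.Lind L₀)) (hR : IsPoint R) (hRd : diaTop _ d ∈ R)
    (I : Set ℕ) (ρ : Prop) (n : ℕ) : Gadget (canonicalTree R hR hRd) I ρ :=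
  (({s | ∃ t, s = .tree t ∧ NormalLogic.mk L₀ (.var n) ∈ t.1.2},
    (NormalLogic.mk (boundDepth L₀ d) (.var n), ⊥)) :
      Set (Point (canonicalTree R hR hRd)) × (NormalLogic.Lind (boundDepth L₀ d) × OnePoint ρ))

theorem base_eval_canonicalVal (ψ : Formula) :
    (eval (canonicalVal R hR hRd I ρ) ψ).base = NormalLogic.mk (boundDepth L₀ d) ψ := by
  rw [Gadget.base_eval]
  exact IsTheory.Lind.eval_mk_var _ ψ

/-- The depth bound prevents the formula from looking past the last level, where the hub is attached
and the unravelling differs from the canonical frame. -/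
theorem sat_eval_canonicalVal (ψ : Formula) (t : (canonicalTree R hR hRd).Node)
    (h : ψ.depth + t.1.1 ≤ d) :
    (eval (canonicalVal R hR hRd I ρ) ψ).Sat (.tree t) ↔ NormalLogic.mk L₀ ψ ∈ t.1.2 := by
  induction ψ generalizing t with
  | var n =>
    constructor
    · rintro ⟨t', ht', hmem⟩
      cases ht'
      exact hmem
    · exact fun hmem => ⟨t, rfl, hmem⟩
  | bot =>
    rw [NormalLogic.mk, IsTheory.Lind.mk_bot]
    exact iff_of_false id t.2.2.1.bot_notMem
  | imp φ ψ h₁ h₂ =>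
    simp only [Formula.depth] at h
    rw [eval_imp, NormalLogic.mk, IsTheory.Lind.mk_imp, t.2.2.1.sup_mem, t.2.2.1.compl_mem,
      Gadget.sat_sup, Gadget.sat_compl, h₁ t (by omega), h₂ t (by omega)]
  | box ψ ih =>
    simp only [Formula.depth] at h
    rw [eval_box, NormalLogic.mk, IsTheory.Lind.mk_box, nec, nec, t.2.2.1.compl_mem,
      Gadget.sat_compl, not_iff_not, Gadget.sat_dia_tree]
    constructor
    · rintro (⟨s, hs, hsat⟩ | hsees | ⟨hd, -⟩)
      · have h₁ : s.1.1 = t.1.1 + 1 := hs.1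
        rw [Gadget.sat_compl, ih s (by omega), ← s.2.2.1.compl_mem] at hsat
        exact hs.2 _ hsat
      · refine t.2.2.1.mem_of_le (dia_mono ?_) hsees.2
        rw [Gadget.base_compl, base_eval_canonicalVal]
        refine inf_le_left.trans ?_
        exact (ofBoundDepth_mk L₀ d ψ.neg).le.trans inf_le_left
      · change t.1.1 = d at hd
        omega
    · intro hmem
      obtain ⟨V, hV, htV, hψV⟩ := exists_sees t.2.2.1 hmem
      -- A successor of small depth is accounted for by the algebra, any other one by a node.
      by_cases hVd : necBot _ (d - t.1.1 - 1) ∈ V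
      · refine Or.inr (Or.inl ⟨show t.1.1 < d by omega, htV _ (hV.mem_of_le ?_
          ((hV.inf_mem _ _).2 ⟨hψV, hVd⟩))⟩)
        refine le_inf ?_ inf_le_right
        rw [Gadget.base_compl, base_eval_canonicalVal]
        refine le_trans ?_ (ofBoundDepth_mk L₀ d ψ.neg).ge
        exact inf_le_inf le_rfl (necBot_mono (by omega))
      · rw [← hV.compl_mem, compl_necBot] at hVd
        have hlt : t.1.1 + 1 ≤ d := by omega
        let s : (canonicalTree R hR hRd).Node :=
          ⟨(t.1.1 + 1, V), hlt, hV, hVd, t.1.2, t.2.2.1, t.2.2.2.2, htV⟩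
        refine Or.inl ⟨s, ⟨rfl, htV⟩, ?_⟩
        rw [Gadget.sat_compl, ih s (by change _ + (t.1.1 + 1) ≤ d; omega)]
        exact (hV.compl_mem _).1 hψV

end CanonicalTree

/-! ### Intersections of `L` with logics of gadgets. -/

namespace Formula

/-- The substitution that frees the first two variables. -/
def shift (φ : Formula) : Formula := φ.subst fun n => var (n + 2)

end Formula

/-- The assignment that extends `θ`, moved by two, by values for the first two variables. -/
def extendVal {M : Type*} (a b : M) (θ : ℕ → M) : ℕ → M
  | 0 => a
  | 1 => b
  | n + 2 => θ n

theorem eval_shift {M : Type*} [ModalAlgebra M] (a b : M) (θ : ℕ → M) (φ : Formula) :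
    eval (extendVal a b θ) φ.shift = eval θ φ := eval_subst _ _ _

theorem IsNormalLogic.or_mem {L : Set Formula} (hL : IsNormalLogic L) {φ : Formula} (h : φ ∈ L)
    (ψ : Formula) : φ.or ψ ∈ L :=
  hL.isTheory.mem_of_imp (φ := φ)
    (fun v => by simp only [Formula.Truth, Formula.or, Formula.neg]; tauto) h

/-- The intersection of a normal logic and the logic of an algebra. -/
def interLogic (L : NormalLogic) (G : Type*) [ModalAlgebra G] : NormalLogic :=
  ⟨L.1 ∩ {φ | Validates G φ},
    { tautology := fun φ h => ⟨L.2.tautology φ h, (isNormalLogic_validates G).tautology φ h⟩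
      modusPonens := fun φ ψ h₁ h₂ => ⟨L.2.modusPonens φ ψ h₁.1 h₂.1,
        (isNormalLogic_validates G).modusPonens φ ψ h₁.2 h₂.2⟩
      substitution := fun s φ h => ⟨L.2.substitution s φ h.1,
        (isNormalLogic_validates G).substitution s φ h.2⟩
      necessitation := fun φ h => ⟨L.2.necessitation φ h.1,
        (isNormalLogic_validates G).necessitation φ h.2⟩
      axiomK_mem := ⟨L.2.axiomK_mem, (isNormalLogic_validates G).axiomK_mem⟩ }⟩

theorem le_of_sup_compl_sup_eq_top {M : Type*} [ModalAlgebra M] {x p y a : M}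
    (h : x ⊔ (pᶜ ⊔ y) = ⊤) (hx : a ≤ xᶜ) (hp : a ≤ p) : a ≤ y := by
  have h₁ : xᶜ ≤ pᶜ ⊔ y := by rwa [← compl_sup_eq_top_iff, compl_compl]
  exact (le_inf (hx.trans h₁) hp).trans (inf_le_iff_le_compl_sup.2 le_rfl)

section Degree

variable {A : Type} [ModalAlgebra A] {d : ℕ} {D : Tree A d} {ρ : Prop} {L : NormalLogic}

/-- The projections to `A` and to the one-point algebra commute with evaluation, and both algebras
validate `φ`; only the points need checking. -/
theorem Gadget.validates_or (hA : ValidatesLogic A L) (hρ : ValidatesLogic (OnePoint ρ) L)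
    {I : Set ℕ} {φ ψ : Formula} (hφ : φ ∈ L.1)
    (h : ∀ (θ : ℕ → Gadget D I ρ) s, ¬ (eval θ φ).Sat s → (eval θ ψ).Sat s) :
    Validates (Gadget D I ρ) (φ.or ψ) := by
  intro θ
  refine Gadget.ext_iff'.2 ⟨fun s => iff_of_true ?_ trivial, ?_, ?_⟩
  · rw [eval_or, Gadget.sat_sup]
    exact or_iff_not_imp_left.2 (h θ s)
  · rw [eval_or, Gadget.base_sup, Gadget.base_eval, hA φ hφ, top_sup_eq, Gadget.base_top]
  · rw [eval_or, Gadget.tip_sup, Gadget.tip_eval, hρ φ hφ, top_sup_eq, Gadget.tip_top]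

/-- Formulas `π` and `c` in the variable `p₀` such that `c` defines the single point frame in the
gadgets over `D` whenever `π` holds somewhere, and such that `π` can be made true wherever a
theorem of `L` is refuted. -/
structure IsDetector (L : NormalLogic) (D : Tree A d) (ρ : Prop) (π c : Formula) : Prop where
  varBound_left : π.varBound ≤ 1
  varBound_right : c.varBound ≤ 1
  isTip : ∀ (I : Set ℕ) (θ : ℕ → Gadget D I ρ) s, (eval θ π).Sat s → Gadget.IsTip (eval θ c)
  exists_sat : ∀ I : Set ℕ, ∃ q : Gadget D I ρ, ∀ s (θ : ℕ → Gadget D I ρ), θ 0 = q →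
    (eval θ π).Sat s
  exists_inf_ne_bot : ∀ (I : Set ℕ) (M : Type u) [ModalAlgebra M],
    ValidatesLogic M (interLogic L (Gadget D I ρ)) → ∀ φ ∈ L.1, ∀ θ : ℕ → M, eval θ φ ≠ ⊤ →
      ∃ q : M, ∀ η : ℕ → M, η 0 = q → (eval θ φ)ᶜ ⊓ eval η π ≠ ⊥

variable {π c : Formula}

/-- Let `φ ∈ L` be refuted. The intersection contains formulas saying that, wherever `φ` fails and
`π` holds, the entrance is within reach and no defect is. By `eq_bot_of_van_benthem` this makes `¬φ
∧ π` empty, against `exists_inf_ne_bot`. -/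
theorem sameVBAOs_interLogic (hA : ValidatesLogic A L) (hd : necBot A d = ⊤)
    (hρ : ValidatesLogic (OnePoint ρ) L) (h : IsDetector.{u} L D ρ π c) (I : Set ℕ) :
    SameVBAOs.{u} L (interLogic L (Gadget D I ρ)) := by
  intro M _ hM
  refine ⟨fun hL φ hφ => hL φ hφ.1, fun hL φ hφ θ => ?_⟩
  by_contra hne
  obtain ⟨q, hq⟩ := h.exists_inf_ne_bot I M hL φ hφ θ hne
  have hshift : φ.shift ∈ L.1 := L.2.substitution _ φ hφ
  -- The variable `p₀` is the parameter of `π` and `c`, and `p₁` is the `u` of the defect, so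
  -- varying `u` leaves `π` and `c` fixed.
  have hπ : ∀ u, eval (extendVal q u θ) π = eval (extendVal q ⊥ θ) π := fun u =>
    eval_congr fun n hn => by
      obtain rfl : n = 0 := by have := h.varBound_left; omega
      rfl
  have hc : ∀ u, eval (extendVal q u θ) c = eval (extendVal q ⊥ θ) c := fun u =>
    eval_congr fun n hn => by
      obtain rfl : n = 0 := by have := h.varBound_right; omega
      rfl
  have h₁ := hL (φ.shift.or (π.imp (.reach (4 * d + 10) (.entrance c (d + 2)))))
    ⟨L.2.or_mem hshift _, Gadget.validates_or hA hρ hshift fun η s _ => by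
      rw [eval_imp, Gadget.sat_sup, Gadget.sat_compl, eval_reach, eval_entrance]
      refine or_iff_not_imp_left.2 fun hs => ?_
      exact Gadget.sat_reach (((h.isTip I η s (not_not.1 hs)).sat_entrance hd _).2 rfl) s⟩
    (extendVal q ⊥ θ)
  have h₂ := fun u => hL (φ.shift.or (π.imp
      (Formula.reach (4 * d + 10) (.defect c (d + 2) (.var 1))).neg))
    ⟨L.2.or_mem hshift _, Gadget.validates_or hA hρ hshift fun η s _ => by
      rw [eval_imp, Gadget.sat_sup, Gadget.sat_compl, eval_neg, eval_reach, eval_defect]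
      refine or_iff_not_imp_left.2 fun hs => ?_
      rw [(h.isTip I η s (not_not.1 hs)).defect_eq_bot hd, reach_bot, compl_bot]
      trivial⟩
    (extendVal q u θ)
  simp only [eval_or, eval_shift, eval_imp, eval_neg, eval_reach, eval_entrance, eval_defect, hπ,
    hc] at h₁ h₂
  refine hq (extendVal q ⊥ θ) rfl (eq_bot_of_van_benthem hM
    (b := entrance (eval (extendVal q ⊥ θ) c) (d + 2))
    (w := region (eval (extendVal q ⊥ θ) c) (d + 2)) inf_le_left
    (le_of_sup_compl_sup_eq_top h₁ inf_le_left inf_le_right)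
    fun u => le_of_sup_compl_sup_eq_top (h₂ u) inf_le_left inf_le_right)

/-- For `n ∉ J`, the gadget of `J` validates that no `n`-marked point is within reach where `φ`
fails and `π` holds. For `n ∈ I`, the root of the gadget of `I` refutes this. -/
theorem subset_of_interLogic_eq (hA : ValidatesLogic A L) (hd : necBot A d = ⊤)
    (hρ : ValidatesLogic (OnePoint ρ) L) (h : IsDetector.{u} L D ρ π c) {φ : Formula}
    (hφ : φ ∈ L.1)
    (href : ∀ I : Set ℕ, ∃ θ : ℕ → Gadget D I ρ, ¬ (eval θ φ).Sat (.tree D.root)) {I J : Set ℕ}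
    (hIJ : interLogic L (Gadget D I ρ) = interLogic L (Gadget D J ρ)) : I ⊆ J := by
  intro n hnI
  by_contra hnJ
  have hshift : φ.shift ∈ L.1 := L.2.substitution _ φ hφ
  have h₁ : φ.shift.or (π.and (.reach (4 * d + 10) (.marked c (d + 2) n))).neg ∈
      (interLogic L (Gadget D J ρ)).1 :=
    ⟨L.2.or_mem hshift _, Gadget.validates_or hA hρ hshift fun η s _ => by
      rw [eval_neg, Gadget.sat_compl, eval_and, Gadget.sat_inf, eval_reach, eval_marked]
      rintro ⟨hs, hs'⟩
      rw [(h.isTip J η s hs).marked_eq_bot hd hnJ, reach_bot] at hs'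
      exact hs'⟩
  rw [← hIJ] at h₁
  obtain ⟨q, hq⟩ := h.exists_sat I
  obtain ⟨θ, hθ⟩ := href I
  have hs := hq (.tree D.root) (extendVal q ⊥ θ) rfl
  have h₂ := (Gadget.sat_top (.tree D.root)).of_le (h₁.2 (extendVal q ⊥ θ)).ge
  rw [eval_or, Gadget.sat_sup, eval_shift, eval_neg, Gadget.sat_compl, eval_and, Gadget.sat_inf,
    eval_reach, eval_marked] at h₂
  refine (h₂.resolve_left hθ) ⟨hs, ?_⟩
  exact Gadget.sat_reach (((h.isTip I _ _ hs).sat_marked hd n _).2 ⟨hnI, rfl⟩) _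

theorem two_pow_le_degree (hA : ValidatesLogic A L) (hd : necBot A d = ⊤)
    (hρ : ValidatesLogic (OnePoint ρ) L) (h : IsDetector.{u} L D ρ π c) {φ : Formula}
    (hφ : φ ∈ L.1)
    (href : ∀ I : Set ℕ, ∃ θ : ℕ → Gadget D I ρ, ¬ (eval θ φ).Sat (.tree D.root)) :
    2 ^ Cardinal.aleph0 ≤ degreeVIncompleteness.{u} L := by
  let f : Set ℕ → {L' : NormalLogic // SameVBAOs.{u} L L'} := fun I =>
    ⟨interLogic L (Gadget D I ρ), sameVBAOs_interLogic hA hd hρ h I⟩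
  have hf : Function.Injective f := fun I J hIJ => by
    have hIJ' := congrArg Subtype.val hIJ
    exact (subset_of_interLogic_eq hA hd hρ h hφ href hIJ').antisymm
      (subset_of_interLogic_eq hA hd hρ h hφ href hIJ'.symm)
  have := Cardinal.mk_le_of_injective hf
  rwa [Cardinal.mk_set, Cardinal.mk_nat] at this

end Degree

/-- A coding of formulas by natural numbers. -/
def Formula.code : Formula → ℕ
  | var n => 4 * n
  | bot => 1
  | imp φ ψ => 4 * Nat.pair (code φ) (code ψ) + 2
  | box φ => 4 * code φ + 3

theorem Formula.code_injective : Function.Injective Formula.code := by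
  intro φ
  induction φ with
  | var n =>
    intro ψ h
    cases ψ <;> simp only [code] at h <;> first | omega | skip
    congr
    omega
  | bot =>
    intro ψ h
    cases ψ <;> simp only [code] at h <;> first | rfl | omega
  | imp φ₁ φ₂ h₁ h₂ =>
    intro ψ h
    cases ψ <;> simp only [code] at h <;> first | omega | skip
    rename_i ψ₁ ψ₂
    have h' : Nat.pair (code φ₁) (code φ₂) = Nat.pair (code ψ₁) (code ψ₂) := by omega
    rw [Nat.pair_eq_pair] at h'
    rw [h₁ h'.1, h₂ h'.2]
  | box φ ih =>
    intro ψ h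
    cases ψ <;> simp only [code] at h <;> first | omega | skip
    rename_i ψ
    rw [ih (show code φ = code ψ by omega)]

theorem degree_le_two_pow (L : NormalLogic) :
    degreeVIncompleteness.{u} L ≤ 2 ^ Cardinal.aleph0 := by
  have h : Cardinal.mk Formula ≤ Cardinal.aleph0 := by
    have := Cardinal.mk_le_of_injective Formula.code_injective
    rwa [Cardinal.mk_nat] at this
  calc degreeVIncompleteness.{u} L ≤ Cardinal.mk NormalLogic := Cardinal.mk_subtype_le _
    _ ≤ Cardinal.mk (Set Formula) := Cardinal.mk_subtype_le _
    _ = 2 ^ Cardinal.mk Formula := Cardinal.mk_set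
    _ ≤ 2 ^ Cardinal.aleph0 := Cardinal.power_le_power_left two_ne_zero h

/-! ### Detecting the tip. -/

namespace Gadget

variable {A : Type} [ModalAlgebra A] {d : ℕ} {D : Tree A d} {I : Set ℕ} {ρ : Prop}

theorem sat_dia_top (s : Point D) : (dia (⊤ : Gadget D I ρ)).Sat s := by
  cases s with
  | tree t =>
    rw [sat_dia_tree]
    rcases (D.level_le t).lt_or_eq with ht | ht
    · obtain ⟨s, hs⟩ := D.exists_rel t ht
      exact Or.inl ⟨s, hs, trivial⟩
    · exact Or.inr (Or.inr ⟨ht, trivial⟩)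
  | link j =>
    rw [sat_dia_link]
    rcases Nat.eq_zero_or_pos j.val with hj | hj
    · exact Or.inr (Or.inl ⟨hj, trivial⟩)
    · exact Or.inl ⟨hj, rfl⟩
  | hub =>
    rw [sat_dia_hub]
    simp [Set.infinite_univ]
  | chain n => exact (sat_dia_chain _ _).2 (Or.inr (Or.inl trivial))

theorem tip_reach (n : ℕ) (x : Gadget D I ρ) : (reach n x).tip = reach n x.tip := by
  induction n with
  | zero => rfl
  | succ n ih => simp [reach, ih]

end Gadget

theorem OnePoint.reach_of_reflexive (n : ℕ) (p : OnePoint True) : reach n p = p := by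
  rcases p.eq_top_or_eq_bot with rfl | rfl
  · exact top_le_iff.1 (le_reach n _)
  · exact reach_bot n

theorem Formula.varBound_reach (n : ℕ) (φ : Formula) : (reach n φ).varBound = φ.varBound := by
  induction n with
  | zero => rfl
  | succ n ih => simp [reach, Formula.or, neg, dia, varBound, ih]

/-- Every point of the gadget has a successor and the tip has none, so `□⊥` needs no parameter. -/
theorem isDetector_of_irreflexive {A : Type} [ModalAlgebra A] {d : ℕ} (L : NormalLogic)
    (D : Tree A d) :
    IsDetector.{u} L D False .top (.boxBot 1) where
  varBound_left := by simp [Formula.top, Formula.neg, Formula.varBound]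
  varBound_right := by simp [Formula.boxBot, Formula.varBound]
  isTip I θ s _ := by
    rw [eval_boxBot, necBot_succ, necBot_zero]
    refine ⟨fun s h => ?_, ?_⟩
    · rw [nec, compl_bot, Gadget.sat_compl] at h
      exact h (Gadget.sat_dia_top s)
    · rw [nec, Gadget.tip_compl, Gadget.tip_dia, OnePoint.dia_of_irreflexive, compl_bot]
  exists_sat I := ⟨⊥, fun s θ _ => by rw [eval_top]; trivial⟩
  exists_inf_ne_bot I M _ _ φ _ θ hne :=
    ⟨⊥, fun η _ => by rw [eval_top, inf_top_eq]; exact mt compl_eq_bot.1 hne⟩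

namespace Formula

/-- Disjunction of the formulas `f 0, …, f (k - 1)`. -/
def any (f : ℕ → Formula) : ℕ → Formula
  | 0 => bot
  | k + 1 => (any f k).or (f k)

/-- Within `n` steps there is a point at which `φ` holds, and one from which no such point can be
reached within `n` steps. -/
def varies (n : ℕ) (φ : Formula) : Formula := (reach n φ).and (reach n (reach n φ).neg)

end Formula

namespace ModalAlgebra

variable {M : Type*} [ModalAlgebra M]

theorem eval_le_eval_any (θ : ℕ → M) (f : ℕ → Formula) {j k : ℕ} (h : j < k) :
    eval θ (f j) ≤ eval θ (.any f k) := by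
  induction k with
  | zero => omega
  | succ k ih =>
    rw [Formula.any, eval_or]
    rcases Nat.lt_succ_iff_lt_or_eq.1 h with h | rfl
    · exact (ih h).trans le_sup_left
    · exact le_sup_right

theorem inf_eval_any_eq_bot (θ : ℕ → M) (f : ℕ → Formula) (k : ℕ) {a : M}
    (h : ∀ j, a ⊓ eval θ (f j) = ⊥) : a ⊓ eval θ (.any f k) = ⊥ := by
  induction k with
  | zero => simp [Formula.any]
  | succ k ih => rw [Formula.any, eval_or, inf_sup_left, ih, h, sup_bot_eq]

theorem eval_varies (θ : ℕ → M) (n : ℕ) (φ : Formula) : eval θ (.varies n φ) =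
    reach n (eval θ φ) ⊓ reach n (reach n (eval θ φ))ᶜ := by
  simp [Formula.varies]

end ModalAlgebra

section Reflexive

variable {A : Type} [ModalAlgebra A] {d : ℕ} {D : Tree A d} {L : NormalLogic} {I : Set ℕ}

theorem Gadget.sat_reach_of_ne_bot [Subsingleton A] {x : Gadget D I True} (hx : x ≠ ⊥)
    (s : Point D) : (reach (4 * d + 10) x).Sat s := by
  by_cases h : ∃ t, x.Sat t
  · obtain ⟨t, ht⟩ := h
    exact Gadget.sat_reach ht s
  · push Not at h
    refine Gadget.sat_reach_of_tip ((OnePoint.eq_top_or_eq_bot _).resolve_right fun htip => hx ?_) s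
    exact Gadget.ext_iff'.2
      ⟨fun t => iff_of_false (h t) (Gadget.not_sat_bot t), Subsingleton.elim _ _, htip⟩

theorem Gadget.sat_varies [Subsingleton A] {x : Gadget D I True} (hx : x ≠ ⊥) (htip : x.tip = ⊥)
    (s : Point D) :
    (reach (4 * d + 10) x ⊓ reach (4 * d + 10) (reach (4 * d + 10) x)ᶜ).Sat s := by
  refine ⟨Gadget.sat_reach_of_ne_bot hx s, Gadget.sat_reach_of_ne_bot (fun h => ?_) s⟩
  have h' := congrArg Gadget.tip h
  rw [Gadget.tip_compl, Gadget.tip_reach, OnePoint.reach_of_reflexive, htip, compl_bot] at h'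
  exact OnePoint.top_ne_bot h'

theorem Gadget.dia_top_of_reflexive [Subsingleton A] : dia (⊤ : Gadget D I True) = ⊤ :=
  Gadget.ext_iff'.2 ⟨fun s => iff_of_true (Gadget.sat_dia_top s) trivial, Subsingleton.elim _ _,
    OnePoint.dia_top_of_reflexive⟩

/-- A theorem of `L` can only be refuted in a gadget if some variable is not constant. -/
theorem Gadget.exists_ne_of_not_sat [Subsingleton A] (hρ : ValidatesLogic (OnePoint True) L)
    {φ : Formula} (hφ : φ ∈ L.1) {θ : ℕ → Gadget D I True} {s : Point D}
    (hs : ¬ (eval θ φ).Sat s) : ∃ j < φ.varBound, θ j ≠ ⊥ ∧ θ j ≠ ⊤ := by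
  by_contra! h
  apply hs
  have h₁ : ∀ j < φ.varBound, θ j = OnePoint.toAlgebra (Gadget D I True) (θ j).tip := by
    intro j hj
    by_cases hj' : θ j = ⊥
    · rw [hj', Gadget.tip_bot, OnePoint.toAlgebra_bot]
    · rw [h j hj hj', Gadget.tip_top, OnePoint.toAlgebra_top]
  rw [eval_congr h₁, OnePoint.eval_toAlgebra_of_reflexive Gadget.dia_top_of_reflexive, hρ φ hφ,
    OnePoint.toAlgebra_top]
  trivial

/-- Since `◇⊤ = ⊤`, no closed formula isolates the tip. But every point reaches any nonzero element
within the bound, as `A` is trivial. So a nonzero complement of what reaches `p₀ ≠ ⊥` can only be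
the tip, and `varies` expresses that both are nonzero. -/
theorem isDetector_of_reflexive [Subsingleton A] (hA : ValidatesLogic A L)
    (hρ : ValidatesLogic (OnePoint True) L) (D : Tree A d) :
    IsDetector.{u} L D True (.varies (4 * d + 10) (.var 0))
      (Formula.reach (4 * d + 10) (.var 0)).neg where
  varBound_left := by
    simp [Formula.varies, Formula.and, Formula.neg, Formula.varBound, Formula.varBound_reach]
  varBound_right := by simp [Formula.neg, Formula.varBound, Formula.varBound_reach]
  isTip I θ s hs := by
    rw [eval_varies, eval_var] at hs
    rw [eval_neg, eval_reach, eval_var]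
    have h₁ : θ 0 ≠ ⊥ := fun h => by
      have := hs.1
      rw [h, reach_bot] at this
      exact this
    have h₂ : (reach (4 * d + 10) (θ 0))ᶜ ≠ ⊥ := fun h => by
      have := hs.2
      rw [h, reach_bot] at this
      exact this
    have h₃ : ∀ t, ¬ (reach (4 * d + 10) (θ 0))ᶜ.Sat t := fun t h =>
      h (Gadget.sat_reach_of_ne_bot h₁ t)
    refine ⟨h₃, (OnePoint.eq_top_or_eq_bot _).resolve_right fun h => h₂ ?_⟩
    exact Gadget.ext_iff'.2 ⟨fun t => iff_of_false (h₃ t) id, Subsingleton.elim _ _, h⟩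
  exists_sat I := by
    let q : Gadget D I True :=
      ((Set.univ, (⊥, ⊥)) : Set (Point D) × (A × OnePoint True))
    refine ⟨q, fun s θ hθ => ?_⟩
    rw [eval_varies, eval_var, hθ]
    refine Gadget.sat_varies (fun h => ?_) rfl s
    have h' : q.Sat s := trivial
    rw [h] at h'
    exact h'
  exists_inf_ne_bot I M _ hM φ hφ θ hne := by
    by_contra! h
    let n := 4 * d + 10
    -- A theorem of `L` fails in the gadget only if some variable is not constant. That variable or
    -- its negation is false at the tip, hence varies, so the disjunction over the variables of `φ`
    -- holds where `φ` fails.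
    let f : ℕ → Formula := fun j =>
      (Formula.varies n (.var j)).or (.varies n (Formula.var j).neg)
    have h₁ := hM (φ.or (.any f φ.varBound)) ⟨L.2.or_mem hφ _,
      Gadget.validates_or hA hρ hφ fun η s hs => by
        obtain ⟨j, hj, hbot, htop⟩ := Gadget.exists_ne_of_not_sat hρ hφ hs
        refine Gadget.Sat.of_le ?_ (eval_le_eval_any η f hj)
        rw [eval_or, eval_varies, eval_varies, eval_neg, eval_var, Gadget.sat_sup]
        rcases (η j).tip.eq_top_or_eq_bot with htip | htip
        · refine Or.inr (Gadget.sat_varies (mt compl_eq_bot.1 htop) ?_ s)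
          rw [Gadget.tip_compl, htip, compl_top]
        · exact Or.inl (Gadget.sat_varies hbot htip s)⟩ θ
    have h₂ : ∀ q : M, (eval θ φ)ᶜ ⊓ (reach n q ⊓ reach n (reach n q)ᶜ) = ⊥ := fun q => by
      obtain ⟨η, rfl, hη⟩ := h q
      rwa [eval_varies, eval_var] at hη
    have h₃ : (eval θ φ)ᶜ ⊓ eval θ (.any f φ.varBound) = ⊥ := inf_eval_any_eq_bot θ f _ fun j => by
      rw [eval_or, eval_varies, eval_varies, inf_sup_left, h₂, h₂, sup_bot_eq]
    rw [eval_or] at h₁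
    have h₄ : (eval θ φ)ᶜ ≤ eval θ (.any f φ.varBound) := by
      rwa [← compl_sup_eq_top_iff, compl_compl]
    rw [inf_eq_left.2 h₄, compl_eq_bot] at h₃
    exact hne h₃

end Reflexive

end ModalLogic

/-! ### The dichotomy. -/

open ModalLogic ModalAlgebra in
theorem theorem7 (L : ModalLogic.NormalLogic) (hcons : ModalLogic.IsConsistent L)
    (hL : ¬ ModalLogic.IsJoinSplitting L) :
    ModalLogic.degreeVIncompleteness.{u} L = 2 ^ Cardinal.aleph0 := by
  refine le_antisymm (degree_le_two_pow L) ?_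
  obtain ⟨L₀, hL₀, φ, hφ, hφ₀⟩ := exists_not_le_of_not_isJoinSplitting hL
  have hle := le_boundDepth_of_splittings hL₀
  have hne : (NormalLogic.mk L₀ φ)ᶜ ≠ ⊥ := fun h =>
    hφ₀ ((IsTheory.Lind.mk_eq_top _).1 (compl_eq_bot.1 h))
  obtain ⟨R, hR, hφR⟩ := exists_isPoint_mem hne
  -- From `φ ∈ L` follows `□ᵈ⊥ → φ ∈ L₀` for `d = φ.depth`; as `R` contains `¬φ`, it omits `□ᵈ⊥`.
  have hRd : diaTop _ φ.depth ∈ R := by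
    rw [← compl_necBot, hR.compl_mem]
    intro h
    rw [← mk_boxBot] at h
    exact (hR.compl_mem _).1 hφR
      (hR.mem_of_le ((IsTheory.Lind.mk_le_mk _).2 (hle φ.depth hφ)) h)
  have hA : ValidatesLogic (NormalLogic.Lind (boundDepth L₀ φ.depth)) L := fun ψ hψ =>
    validatesLogic_lind _ ψ (hle _ hψ)
  have hd := necBot_boundDepth L₀ φ.depth
  have href : ∀ (ρ : Prop) (I : Set ℕ), ∃ θ : ℕ → Gadget (canonicalTree R hR hRd) I ρ,
      ¬ (eval θ φ).Sat (.tree (canonicalTree R hR hRd).root) := fun ρ I =>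
    ⟨canonicalVal R hR hRd I ρ, fun h =>
      (hR.compl_mem _).1 hφR ((sat_eval_canonicalVal φ _ le_rfl).1 h)⟩
  rcases validates_onePoint hcons hL₀ with hρ | ⟨hρ, hbot⟩
  · exact two_pow_le_degree hA hd hρ (isDetector_of_irreflexive.{u} L _) hφ (href False)
  · have : Subsingleton (NormalLogic.Lind (boundDepth L₀ φ.depth)) := by
      have h := (IsTheory.Lind.mk_eq_top (boundDepth L₀ φ.depth).2.isTheory).2 (hbot φ.depth)
      rw [IsTheory.Lind.mk_bot] at h
      exact subsingleton_of_bot_eq_top h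
    exact two_pow_le_degree hA hd hρ (isDetector_of_reflexive.{u} hA hρ _) hφ (href True)
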